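/- Let $n\ge 3$ and $1<p<\infty$. Let $Cl_n$ be the real Clifford algebra generated by $e_1,\dots,e_n$ with $e_ie_j+e_je_i=-2\delta_{ij}$, normed by the Euclidean norm of the coefficients with respect to the basis of products $e_A$, and let $Cl_{n-1}$ be the subalgebra generated by $e_1,\dots,e_{n-1}$. Every $A\in Cl_n$ is uniquely $A=B+Ce_n$ with $B,C\in Cl_{n-1}$; put $P(A)=B$, $Q(A)=C$, $\hat A=B-Ce_n$, $Q'(A)=-e_nQ(A)e_n$. Vectors $x=x_1e_1+\dots+x_ne_n\in\mathbb R^n$ are regarded as elements of $Cl_n$, so $\hat x$ is the reflection of $x$ about $\mathbb R^{n-1}=\mathrm{span}(e_1,\dots,e_{n-1})$. Let $\mathbb R^{n,+}=\{y\in\mathbb R^n: y_n>0\}$, let $\omega_n$ be the surface area of the unit sphere in $\mathbb R^n$, and put $$E(x,y)=\frac{(x-y)^{-1}}{\|x-y\|^{n-2}\|x-\hat y\|^{n-2}},\qquad F(x,y)=\frac{(\hat x-y)^{-1}}{\|x-y\|^{n-2}\|\hat x-y\|^{n-2}},$$ with inverses taken in $Cl_n$. (i) Let $\varphi\in L^p(\mathbb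 R^{n-1};Cl_n)$. For every $y\in\mathbb R^{n,+}$ the integral in $$f(y)=-\frac{2^{n-2}y_n^{n-2}}{\omega_n}\int_{\mathbb R^{n-1}}\bigl(E(x,y)e_n\varphi(x)+F(x,y)e_n\hat\varphi(x)\bigr)\,dx$$ converges absolutely. For almost every $y'\in\mathbb R^{n-1}$, along every vertical approach $y(t)=y'+y_n(t)e_n$ with $y_n(t)>0$ and $y_n(t)\to0$ as $t\to 0^+$, $$\lim_{t\to0^+}f(y(t))=P(\varphi(y')).$$ (ii) The function $f$ is differentiable and solves the Dirac-Hodge equation $$\sum_{j=1}^n e_j\frac{\partial f}{\partial y_j}+\frac{n-2}{y_n}Q'(f)=0$$ on $\mathbb R^{n,+}$. If $\varphi$ takes values in $Cl_{n-1}$ almost everywhere, then for almost every $y'$, $f(y(t))\to\varphi(y')$ along every such vertical approach; that is, $f$ solves the Dirichlet problem for the Dirac-Hodge equation with boundary data $\varphi$. (iii) If $\varphi\in L^p(\mathbb R^{n-1};\mathbb R)$ is real valued, then the real part of $f(y)$ (its coefficient at the basis element $1$) is, for every $y\in\mathbb R^{n,+}$, the absolutely convergent Poisson integral $$u(y)=\frac{2^{n-2}y_n^{n-1}}{\omega_n}\int_{\mathbb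 R^{n-1}}\left(\frac{\varphi(x)}{\|x-y\|^{n}\|x-\hat y\|^{n-2}}+\frac{\varphi(x)}{\|x-y\|^{n-2}\|x-\hat y\|^{n}}\right)dx .$$ The function $u$ is $C^2$ and hyperbolic harmonic on $\mathbb R^{n,+}$, i.e. $\triangle u-\frac{n-2}{y_n}\frac{\partial u}{\partial y_n}=0$ with $\triangle$ the Euclidean Laplacian, and for almost every $y'$, $u(y(t))\to\varphi(y')$ along every such vertical approach. -/

import Mathlib

open MeasureTheory Filter Topology
open scoped ENNReal

noncomputable section

namespace HyperbolicClifford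

/-! ### The Clifford algebra of negative definite Euclidean space -/

/-- Euclidean space `R^n`. -/
abbrev E (n : ℕ) : Type := EuclideanSpace ℝ (Fin n)

/-- The negative definite quadratic form `x ↦ -‖x‖²` on `R^n`. -/
def negForm (n : ℕ) : QuadraticForm ℝ (E n) :=
  -LinearMap.BilinMap.toQuadraticMap (innerₗ (E n))

theorem negForm_apply (n : ℕ) (x : E n) : negForm n x = -‖x‖ ^ 2 := by
  simp [negForm, LinearMap.BilinMap.toQuadraticMap_apply]

/-- The Clifford algebra `Cl_n`, in which `v * v = -‖v‖²` for vectors `v`. -/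
abbrev Cl (n : ℕ) : Type := CliffordAlgebra (negForm n)

/-- The inclusion of `R^n` in `Cl_n`. -/
abbrev vec {n : ℕ} : E n →ₗ[ℝ] Cl n := CliffordAlgebra.ι (negForm n)

/-- The generator `e_i` of `Cl_n`. -/
def gen {n : ℕ} (i : Fin n) : Cl n := vec (EuclideanSpace.single i 1)

/-- The basis `e_A = e_{α₁} ⋯ e_{α_h}` of `Cl_n`, for `A = {α₁ < ⋯ < α_h}`
(see `clBasis_apply`). -/
def clBasis (n : ℕ) : Module.Basis (Finset (Fin n)) ℝ (Cl n) :=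
  ((EuclideanSpace.basisFun (Fin n) ℝ).toBasis.ExteriorAlgebra).map
    (CliffordAlgebra.equivExterior (negForm n)).symm

theorem equivExterior_prod_gen {n : ℕ} (l : List (Fin n)) (hl : l.Nodup) :
    CliffordAlgebra.equivExterior (negForm n) (l.map gen).prod =
      (l.map fun i => ExteriorAlgebra.ι ℝ (EuclideanSpace.single i (1 : ℝ) : E n)).prod := by
  have key : ∀ (i : Fin n) (l : List (Fin n)), i ∉ l →
      ∀ d : Module.Dual ℝ (E n), (∀ j ≠ i, d (EuclideanSpace.single j 1) = 0) →
      CliffordAlgebra.contractLeft (Q := (0 : QuadraticForm ℝ (E n))) d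
        ((l.map fun i => ExteriorAlgebra.ι ℝ (EuclideanSpace.single i (1 : ℝ) : E n)).prod :
          ExteriorAlgebra ℝ (E n)) = 0 := by
    intro i l hi d hd
    induction l with
    | nil => exact CliffordAlgebra.contractLeft_one (Q := (0 : QuadraticForm ℝ (E n))) d
    | cons j l ih =>
      simp only [List.mem_cons, not_or] at hi
      rw [List.map_cons, List.prod_cons]
      refine (CliffordAlgebra.contractLeft_ι_mul (Q := (0 : QuadraticForm ℝ (E n))) d _ _).trans ?_
      rw [ih hi.2, hd j (Ne.symm hi.1)]
      simp
  induction l with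
  | nil => simp
  | cons i l ih =>
    rw [List.nodup_cons] at hl
    have ih := ih hl.2
    rw [CliffordAlgebra.equivExterior, CliffordAlgebra.changeFormEquiv_apply] at ih ⊢
    rw [List.map_cons, List.prod_cons, List.map_cons, List.prod_cons, gen,
      CliffordAlgebra.changeForm_ι_mul, ih, key i l hl.1, sub_zero]
    intro j hj
    simp [negForm, hj, hj.symm, QuadraticMap.associated_apply,
      LinearMap.BilinMap.toQuadraticMap_apply, inner_add_right,
      EuclideanSpace.inner_single_left]

theorem clBasis_apply {n : ℕ} (A : Finset (Fin n)) :
    clBasis n A = (A.sort.map gen).prod := by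
  rw [clBasis, Module.Basis.map_apply, LinearEquiv.symm_apply_eq,
    equivExterior_prod_gen _ (A.sort_nodup _), ExteriorAlgebra.basis_apply_ofCard _ rfl,
    ExteriorAlgebra.ιMulti_family, ExteriorAlgebra.ιMulti_apply]
  congr 1
  apply List.ext_getElem
  · simp
  · intro k h1 h2
    simp [Set.powersetCard.ofFinEmbEquiv_symm_apply, Finset.orderEmbOfFin_apply]

/-- The coefficients of an element of `Cl_n` with respect to the basis `e_A`, as a vector of the
Euclidean space of dimension `2^n`. -/
def clCoords (n : ℕ) : Cl n →ₗ[ℝ] EuclideanSpace ℝ (Finset (Fin n)) :=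
  ((clBasis n).equivFun.trans (WithLp.linearEquiv 2 ℝ (Finset (Fin n) → ℝ)).symm).toLinearMap

theorem clCoords_injective (n : ℕ) : Function.Injective (clCoords n) :=
  ((clBasis n).equivFun.trans (WithLp.linearEquiv 2 ℝ (Finset (Fin n) → ℝ)).symm).injective

/-- The norm `‖A‖ = (∑ a_A ^ 2) ^ (1 / 2)` on `Cl_n`. -/
instance clNormedAddCommGroup (n : ℕ) : NormedAddCommGroup (Cl n) :=
  NormedAddCommGroup.induced _ _ (clCoords n) (clCoords_injective n)

instance clNormedSpace (n : ℕ) : NormedSpace ℝ (Cl n) :=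
  NormedSpace.induced ℝ _ _ (clCoords n)

theorem cl_norm_eq {n : ℕ} (A : Cl n) : ‖A‖ = √(∑ S, (clBasis n).repr A S ^ 2) := by
  have h : ‖A‖ = ‖clCoords n A‖ := rfl
  rw [h, EuclideanSpace.norm_eq]
  simp [clCoords]

/-- The real part of an element of `Cl_n`: its coefficient at the basis element `1`. -/
def re {n : ℕ} (A : Cl n) : ℝ := (clBasis n).repr A ∅

/-! ### The splitting `Cl_n = Cl_{n-1} + Cl_{n-1} e_n`

From here on `n = m + 1`; the last coordinate, with index `Fin.last m`, is the one written `x_n`. -/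

/-- The last basis vector `e_n` in `Cl_n`. -/
def eLast (m : ℕ) : Cl (m + 1) := gen (Fin.last m)

/-- The subalgebra `Cl_{n-1}` of `Cl_n` generated by `e_1, …, e_{n-1}`. -/
def clSub (m : ℕ) : Subalgebra ℝ (Cl (m + 1)) :=
  Algebra.adjoin ℝ (Set.range fun i : Fin m => gen i.castSucc)

/-- The reflection `x ↦ x̂` of `R^n` about `R^{n-1}`, changing the sign of the last coordinate. -/
def reflect (m : ℕ) : E (m + 1) →ₗ[ℝ] E (m + 1) where
  toFun x := WithLp.toLp 2 fun i => if i = Fin.last m then -x i else x i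
  map_add' x y := by
    ext i
    by_cases h : i = Fin.last m <;> simp [h, add_comm]
  map_smul' c x := by
    ext i
    by_cases h : i = Fin.last m <;> simp [h]

theorem negForm_reflect (m : ℕ) (x : E (m + 1)) :
    negForm (m + 1) (reflect m x) = negForm (m + 1) x := by
  rw [negForm_apply, negForm_apply, EuclideanSpace.norm_sq_eq, EuclideanSpace.norm_sq_eq]
  congr 1
  refine Finset.sum_congr rfl fun i _ => ?_
  by_cases h : i = Fin.last m <;> simp [reflect, h]

/-- The automorphism `A = B + C e_n ↦ Â = B - C e_n` of `Cl_n` (with `B, C ∈ Cl_{n-1}`), that is,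
the automorphism induced by the reflection `x ↦ x̂` (see `hat_add_mul_eLast`). -/
def hat (m : ℕ) : Cl (m + 1) →ₐ[ℝ] Cl (m + 1) :=
  CliffordAlgebra.map ⟨reflect m, negForm_reflect m⟩

/-- The projection `P (B + C e_n) = B`, for `B, C ∈ Cl_{n-1}` (see `projP_add_mul_eLast`). -/
def projP {m : ℕ} (A : Cl (m + 1)) : Cl (m + 1) := (1 / 2 : ℝ) • (A + hat m A)

/-- The projection `Q (B + C e_n) = C`, for `B, C ∈ Cl_{n-1}` (see `projQ_add_mul_eLast`). -/
def projQ {m : ℕ} (A : Cl (m + 1)) : Cl (m + 1) := (-1 / 2 : ℝ) • ((A - hat m A) * eLast m)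

/-- `Q' A = -e_n (Q A) e_n`. -/
def projQ' {m : ℕ} (A : Cl (m + 1)) : Cl (m + 1) := -(eLast m * projQ A * eLast m)

theorem gen_mul_self {n : ℕ} (i : Fin n) : gen i * gen i = (-1 : Cl n) := by
  rw [gen, vec, CliffordAlgebra.ι_sq_scalar, negForm_apply]
  simp

theorem gen_mul_gen {n : ℕ} {i j : Fin n} (h : i ≠ j) : gen i * gen j = -(gen j * gen i) := by
  rw [gen, gen, vec]
  apply CliffordAlgebra.ι_mul_ι_comm_of_isOrtho
  rw [QuadraticMap.isOrtho_def]
  simp only [negForm_apply, EuclideanSpace.norm_sq_eq, ← Finset.sum_neg_distrib,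
    ← Finset.sum_add_distrib]
  refine Finset.sum_congr rfl fun k _ => ?_
  by_cases h1 : k = i
  · subst h1; simp [h]
  · simp [h1]

theorem hat_vec {m : ℕ} (v : E (m + 1)) : hat m (vec v) = vec (reflect m v) :=
  CliffordAlgebra.map_apply_ι _ _

theorem hat_gen_castSucc {m : ℕ} (i : Fin m) : hat m (gen i.castSucc) = gen i.castSucc := by
  rw [gen, hat_vec]
  congr 1
  ext j
  by_cases h : j = Fin.last m
  · subst h
    simp [reflect, (Fin.castSucc_lt_last i).ne']
  · simp [reflect, h]

theorem hat_eLast (m : ℕ) : hat m (eLast m) = -eLast m := by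
  rw [eLast, gen, hat_vec, ← map_neg]
  congr 1
  ext j
  by_cases h : j = Fin.last m <;> simp [reflect, h]

theorem hat_of_mem {m : ℕ} {A : Cl (m + 1)} (hA : A ∈ clSub m) : hat m A = A := by
  induction hA using Algebra.adjoin_induction with
  | mem x hx => obtain ⟨i, rfl⟩ := hx; exact hat_gen_castSucc i
  | algebraMap r => simp
  | add x y _ _ hx hy => rw [map_add, hx, hy]
  | mul x y _ _ hx hy => rw [map_mul, hx, hy]

theorem exists_mul_eLast {m : ℕ} {A : Cl (m + 1)} (hA : A ∈ clSub m) :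
    ∃ B ∈ clSub m, eLast m * A = B * eLast m := by
  induction hA using Algebra.adjoin_induction with
  | mem x hx =>
    obtain ⟨i, rfl⟩ := hx
    refine ⟨-gen i.castSucc, neg_mem (Algebra.subset_adjoin ⟨i, rfl⟩), ?_⟩
    rw [eLast, gen_mul_gen (Fin.castSucc_lt_last i).ne', neg_mul]
  | algebraMap r => exact ⟨_, algebraMap_mem _ r, (Algebra.commutes r _).symm⟩
  | add x y _ _ hx hy =>
    obtain ⟨B, hB, h⟩ := hx
    obtain ⟨C, hC, h'⟩ := hy
    exact ⟨B + C, add_mem hB hC, by rw [mul_add, h, h', add_mul]⟩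
  | mul x y _ _ hx hy =>
    obtain ⟨B, hB, h⟩ := hx
    obtain ⟨C, hC, h'⟩ := hy
    exact ⟨B * C, mul_mem hB hC, by rw [← mul_assoc, h, mul_assoc, h', mul_assoc]⟩

/-- `Cl_n = Cl_{n-1} + Cl_{n-1} e_n`. -/
theorem exists_add_mul_eLast {m : ℕ} (A : Cl (m + 1)) :
    ∃ B ∈ clSub m, ∃ C ∈ clSub m, A = B + C * eLast m := by
  induction A using CliffordAlgebra.left_induction with
  | algebraMap r => exact ⟨_, algebraMap_mem _ r, 0, zero_mem _, by simp⟩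
  | add x y hx hy =>
    obtain ⟨B, hB, C, hC, rfl⟩ := hx
    obtain ⟨B', hB', C', hC', rfl⟩ := hy
    exact ⟨B + B', add_mem hB hB', C + C', add_mem hC hC', by rw [add_mul]; abel⟩
  | ι_mul x v hx =>
    obtain ⟨B, hB, C, hC, rfl⟩ := hx
    have hv : CliffordAlgebra.ι (negForm (m + 1)) v =
        (∑ i : Fin m, v i.castSucc • gen i.castSucc) + v (Fin.last m) • eLast m := by
      have : v = ∑ i, v i • (EuclideanSpace.single i (1 : ℝ) : E (m + 1)) := by
        ext j; simp [Finset.sum_apply, Pi.single_apply]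
      conv_lhs => rw [this]
      rw [map_sum, Fin.sum_univ_castSucc]
      simp [gen, eLast]
    set w := ∑ i : Fin m, v i.castSucc • gen i.castSucc with hw
    have hw' : w ∈ clSub m :=
      sum_mem fun i _ => Subalgebra.smul_mem _ (Algebra.subset_adjoin (Set.mem_range_self i)) _
    obtain ⟨B', hB', h1⟩ := exists_mul_eLast hB
    obtain ⟨C', hC', h2⟩ := exists_mul_eLast hC
    refine ⟨w * B - v (Fin.last m) • C', sub_mem (mul_mem hw' hB) (Subalgebra.smul_mem _ hC' _),
      w * C + v (Fin.last m) • B', add_mem (mul_mem hw' hC) (Subalgebra.smul_mem _ hB' _), ?_⟩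
    have h3 : eLast m * (C * eLast m) = -C' := by
      rw [← mul_assoc, h2, mul_assoc, eLast, gen_mul_self, mul_neg, mul_one]
    rw [hv, add_mul, mul_add, mul_add, smul_mul_assoc, smul_mul_assoc, h1, h3, add_mul,
      smul_mul_assoc, mul_assoc, smul_neg]
    abel

theorem hat_add_mul_eLast {m : ℕ} {B C : Cl (m + 1)} (hB : B ∈ clSub m) (hC : C ∈ clSub m) :
    hat m (B + C * eLast m) = B - C * eLast m := by
  rw [map_add, map_mul, hat_of_mem hB, hat_of_mem hC, hat_eLast, mul_neg, sub_eq_add_neg]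

theorem projP_add_mul_eLast {m : ℕ} {B C : Cl (m + 1)} (hB : B ∈ clSub m) (hC : C ∈ clSub m) :
    projP (B + C * eLast m) = B := by
  rw [projP, hat_add_mul_eLast hB hC]
  module

theorem projQ_add_mul_eLast {m : ℕ} {B C : Cl (m + 1)} (hB : B ∈ clSub m) (hC : C ∈ clSub m) :
    projQ (B + C * eLast m) = C := by
  have h : B + C * eLast m - (B - C * eLast m) = (2 : ℝ) • (C * eLast m) := by module
  rw [projQ, hat_add_mul_eLast hB hC, h, smul_mul_assoc, mul_assoc, eLast, gen_mul_self, mul_neg, mul_one]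
  module

/-! ### Upper half space, the Dirac-Hodge operator and the hyperbolic Laplacian -/

/-- Upper half space `R^{n,+}`. -/
def upperHalf (m : ℕ) : Set (E (m + 1)) := {y | 0 < y (Fin.last m)}

/-- The point `x' + s e_n` of `R^n`, for `x' ∈ R^{n-1}` and real `s`. -/
def pt {m : ℕ} (x' : E m) (s : ℝ) : E (m + 1) :=
  WithLp.toLp 2 (Fin.snoc (α := fun _ => ℝ) x'.ofLp s)

/-- The Dirac-Hodge operator `M f = ∑ e_j ∂f/∂x_j + ((n - 2) / x_n) Q' f`, with `n = m + 1`. -/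
def diracHodge {m : ℕ} (f : E (m + 1) → Cl (m + 1)) (x : E (m + 1)) : Cl (m + 1) :=
  ∑ j, gen j * fderiv ℝ f x (EuclideanSpace.single j 1) +
    (((m : ℝ) - 1) / x (Fin.last m)) • projQ' (f x)

/-- Solutions of the Dirac-Hodge equation (hypermonogenic functions) on `U`. -/
def IsHypermonogenicOn {m : ℕ} (f : E (m + 1) → Cl (m + 1)) (U : Set (E (m + 1))) : Prop :=
  ∀ x ∈ U, DifferentiableAt ℝ f x ∧ diracHodge f x = 0

/-- Real-valued hyperbolic harmonic functions on `U`: `C²` solutions of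
`Δ u - ((n - 2) / x_n) ∂u/∂x_n = 0`, with `n = m + 1`. -/
def IsHyperbolicHarmonicOn {m : ℕ} (u : E (m + 1) → ℝ) (U : Set (E (m + 1))) : Prop :=
  ContDiffOn ℝ 2 u U ∧ ∀ x ∈ U,
    Laplacian.laplacian u x -
      ((m : ℝ) - 1) / x (Fin.last m) * fderiv ℝ u x (EuclideanSpace.single (Fin.last m) 1) = 0

/-! ### The kernels and the boundary integral -/

/-- `ω_n`, the surface area of the unit sphere in `R^n`. -/
def sphereArea (n : ℕ) : ℝ := (volume : Measure (E n)).toSphere.real Set.univ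

/-- `E(x, y) = (x - y)⁻¹ / (‖x - y‖^(n-2) ‖x - ŷ‖^(n-2))`, with the inverse taken in `Cl_n`, and
`n - 2 = m - 1`. -/
def kerE {m : ℕ} (x y : E (m + 1)) : Cl (m + 1) :=
  (‖x - y‖ ^ (m - 1) * ‖x - reflect m y‖ ^ (m - 1))⁻¹ • Ring.inverse (vec (x - y))

/-- `F(x, y) = (x̂ - y)⁻¹ / (‖x - y‖^(n-2) ‖x̂ - y‖^(n-2))`, with the inverse taken in `Cl_n`, and
`n - 2 = m - 1`. -/
def kerF {m : ℕ} (x y : E (m + 1)) : Cl (m + 1) :=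
  (‖x - y‖ ^ (m - 1) * ‖reflect m x - y‖ ^ (m - 1))⁻¹ • Ring.inverse (vec (reflect m x - y))

/-- The integrand `E(x, y) e_n φ(x) + F(x, y) e_n φ̂(x)`, for `x ∈ R^{n-1}` in the boundary. -/
def integrand {m : ℕ} (φ : E m → Cl (m + 1)) (y : E (m + 1)) (x : E m) : Cl (m + 1) :=
  kerE (pt x 0) y * eLast m * φ x + kerF (pt x 0) y * eLast m * hat m (φ x)

/-- The boundary integral
`-(2^(n-2) y_n^(n-2) / ω_n) ∫_{R^{n-1}} (E(x, y) e_n φ(x) + F(x, y) e_n φ̂(x)) dx`.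
The sign is that of the outer unit normal `-e_n` of upper half space. -/
def boundaryIntegral {m : ℕ} (φ : E m → Cl (m + 1)) (y : E (m + 1)) : Cl (m + 1) :=
  -(2 ^ (m - 1) * y (Fin.last m) ^ (m - 1) / sphereArea (m + 1)) • ∫ x : E m, integrand φ y x

/-- The integrand of the Poisson integral. -/
def poissonIntegrand {m : ℕ} (ψ : E m → ℝ) (y : E (m + 1)) (x : E m) : ℝ :=
  ψ x / (‖pt x 0 - y‖ ^ (m + 1) * ‖pt x 0 - reflect m y‖ ^ (m - 1)) +
    ψ x / (‖pt x 0 - y‖ ^ (m - 1) * ‖pt x 0 - reflect m y‖ ^ (m + 1))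

/-- The Poisson integral of `ψ : R^{n-1} → ℝ`, with `n = m + 1`. -/
def poissonIntegral {m : ℕ} (ψ : E m → ℝ) (y : E (m + 1)) : ℝ :=
  2 ^ (m - 1) * y (Fin.last m) ^ m / sphereArea (m + 1) * ∫ x : E m, poissonIntegrand ψ y x

end HyperbolicClifford

end

open HyperbolicClifford

namespace HyperbolicClifford

open scoped ContDiff

/-! ### Boundary points -/

section Boundary

variable {m : ℕ}

/-! Write `m = n - 1` and `z = y - x`. For `x` in the boundary, `x̂ = x` and the reflection is an
isometry, so `E = F = ‖z‖^(-2m) z`; as `φ + φ̂ = 2 P(φ)`, the integrand is `2 ‖z‖^(-2m) z e_n P(φ)`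
(`integrand_eq`). The Poisson integrand is `2 ‖z‖^(-2m) φ`. Both integrals are thus potentials `∫
g(y - x) (φ x) dx` with `g` homogeneous of degree `-q`, where `q = 2m - 1` or `q = 2m`. Since `m ≥
2`, `q ≥ m + 1`, so `g(y - x)` decays at least like `(1 + ‖x‖)^(-(m+1))`, locally uniformly in `y`.
This weight is bounded and integrable, hence integrates against every `L^p` density. Convergence and
differentiation under the integral follow (`hasFDerivAt_potential`). The differential equations then
reduce to pointwise kernel identities, combined with the product rule for the power of `y_n` in
front. For boundary values, homogeneity turns `s^(q-m)` times the potential at height `s` into `∫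
g(u, 1) φ(y' - s u) du`, which tends to `∫ g(u, 1) φ(y') du` at every Lebesgue point `y'`
(`ae_tendsto_potential`). The normalisation is `∫ (1 + ‖u‖²)^(-m) du = ω_n / 2^m`
(`integral_inv_one_add_norm_sq_pow`); in the Clifford case the horizontal part of `(u, 1)` is odd
and integrates to zero. -/

@[simp] theorem pt_castSucc (x : E m) (s : ℝ) (i : Fin m) : pt x s i.castSucc = x i := by
  simp [pt]

@[simp] theorem pt_last (x : E m) (s : ℝ) : pt x s (Fin.last m) = s := by
  simp [pt]

theorem norm_pt_sq (x : E m) (s : ℝ) : ‖pt x s‖ ^ 2 = ‖x‖ ^ 2 + s ^ 2 := by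
  rw [EuclideanSpace.norm_sq_eq, EuclideanSpace.norm_sq_eq, Fin.sum_univ_castSucc]
  simp

theorem norm_pt_zero (x : E m) : ‖pt x 0‖ = ‖x‖ := by
  have h := norm_pt_sq x 0
  rw [zero_pow two_ne_zero, add_zero] at h
  exact (pow_left_inj₀ (norm_nonneg _) (norm_nonneg _) two_ne_zero).1 h

theorem pt_sub_pt (x y : E m) (s t : ℝ) : pt x s - pt y t = pt (x - y) (s - t) := by
  ext i
  refine Fin.lastCases ?_ (fun i => ?_) i <;> simp

theorem smul_pt (c : ℝ) (x : E m) (s : ℝ) : c • pt x s = pt (c • x) (c * s) := by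
  ext i
  refine Fin.lastCases ?_ (fun i => ?_) i <;> simp

@[fun_prop]
theorem continuous_pt (s : ℝ) : Continuous fun x : E m => pt x s := by
  refine (Isometry.of_dist_eq fun x y => ?_).continuous
  rw [dist_eq_norm, dist_eq_norm, pt_sub_pt, sub_self, norm_pt_zero]

theorem reflect_pt_zero (x : E m) : reflect m (pt x 0) = pt x 0 := by
  ext i
  refine Fin.lastCases ?_ (fun i => ?_) i <;> simp [reflect]

theorem norm_reflect (x : E (m + 1)) : ‖reflect m x‖ = ‖x‖ := by
  have h := negForm_reflect m x
  rw [negForm_apply, negForm_apply, neg_inj] at h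
  exact (pow_left_inj₀ (norm_nonneg _) (norm_nonneg _) two_ne_zero).1 h

theorem last_le_norm_sub_pt (y : E (m + 1)) (x : E m) : y (Fin.last m) ≤ ‖y - pt x 0‖ := by
  have h := PiLp.norm_apply_le (y - pt x 0) (Fin.last m)
  rw [PiLp.sub_apply, pt_last, sub_zero] at h
  exact (le_abs_self _).trans h

theorem sub_pt_ne_zero {y : E (m + 1)} (hy : y ∈ upperHalf m) (x : E m) : y - pt x 0 ≠ 0 :=
  norm_pos_iff.1 (lt_of_lt_of_le hy (last_le_norm_sub_pt y x))

theorem isOpen_upperHalf (m : ℕ) : IsOpen (upperHalf m) :=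
  isOpen_lt continuous_const (by fun_prop)

theorem exists_ball_norm_sub_pt {y₀ : E (m + 1)} (hy₀ : y₀ ∈ upperHalf m) :
    ∃ ε > 0, ∃ c > 0, ∀ y ∈ Metric.ball y₀ ε, y ∈ upperHalf m ∧
      ∀ x : E m, ‖y - pt x 0‖⁻¹ ≤ c * (1 + ‖x‖)⁻¹ := by
  set s := y₀ (Fin.last m) with hs
  have hs0 : 0 < s := hy₀
  set M := ‖y₀‖ + s / 2 with hM
  refine ⟨s / 2, by positivity, 1 + (1 + M) / (s / 2), by positivity, fun y hy => ?_⟩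
  rw [Metric.mem_ball, dist_eq_norm] at hy
  have h1 : s / 2 ≤ y (Fin.last m) := by
    have h := PiLp.norm_apply_le (y - y₀) (Fin.last m)
    rw [PiLp.sub_apply, Real.norm_eq_abs] at h
    have := (abs_le.1 (h.trans hy.le)).1
    linarith
  have h2 : ‖y‖ ≤ M := by
    have := norm_sub_norm_le y y₀
    linarith
  refine ⟨lt_of_lt_of_le (by positivity) h1, fun x => ?_⟩
  set d := ‖y - pt x 0‖
  have h3 : s / 2 ≤ d := h1.trans (last_le_norm_sub_pt y x)
  have h4 : ‖x‖ ≤ d + M := by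
    have := norm_sub_norm_le (pt x 0) y
    rw [norm_sub_rev, norm_pt_zero] at this
    linarith
  have hd : 0 < d := lt_of_lt_of_le (by positivity) h3
  rw [← div_eq_mul_inv, inv_le_comm₀ hd (by positivity), inv_div,
    div_le_iff₀ (by positivity)]
  have h5 : 1 + M ≤ d * ((1 + M) / (s / 2)) := by
    rw [mul_div_assoc', le_div_iff₀ (by positivity), mul_comm]
    exact mul_le_mul_of_nonneg_right h3 (by positivity)
  linarith

end Boundary

/-! ### Homogeneous kernels -/

/-- Smooth functions on the punctured space, positively homogeneous of degree `-q`. -/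
structure IsHomogeneousKernel {X W : Type*} [NormedAddCommGroup X] [NormedSpace ℝ X]
    [NormedAddCommGroup W] [NormedSpace ℝ W] (q : ℕ) (g : X → W) : Prop where
  contDiffOn : ContDiffOn ℝ ∞ g {0}ᶜ
  map_smul : ∀ t : ℝ, 0 < t → ∀ z ≠ 0, g (t • z) = t⁻¹ ^ q • g z

namespace IsHomogeneousKernel

variable {X W W' : Type*} [NormedAddCommGroup X] [NormedSpace ℝ X]
  [NormedAddCommGroup W] [NormedSpace ℝ W] [NormedAddCommGroup W'] [NormedSpace ℝ W']
  {q : ℕ} {g : X → W}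

theorem continuousOn (hg : IsHomogeneousKernel q g) : ContinuousOn g {0}ᶜ :=
  hg.contDiffOn.continuousOn

theorem hasFDerivAt (hg : IsHomogeneousKernel q g) {z : X} (hz : z ≠ 0) :
    HasFDerivAt g (fderiv ℝ g z) z :=
  ((hg.contDiffOn.contDiffAt (isOpen_compl_singleton.mem_nhds hz)).differentiableAt
    (by simp)).hasFDerivAt

theorem clm_comp (hg : IsHomogeneousKernel q g) (L : W →L[ℝ] W') :
    IsHomogeneousKernel q fun z => L (g z) where
  contDiffOn := L.contDiff.comp_contDiffOn hg.contDiffOn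
  map_smul t ht z hz := by rw [hg.map_smul t ht z hz, L.map_smul]

/-- Differentiating `g (t w) = t^(-q) g w` in `w` produces a factor `t` on the left. Requiring
smoothness of all orders keeps the class closed under differentiation. -/
theorem fderiv_right (hg : IsHomogeneousKernel q g) :
    IsHomogeneousKernel (q + 1) (_root_.fderiv ℝ g) where
  contDiffOn := hg.contDiffOn.fderiv_of_isOpen isOpen_compl_singleton (by simp)
  map_smul t ht z hz := by
    have h1 : (fun w => g (t • w)) =ᶠ[𝓝 z] fun w => t⁻¹ ^ q • g w := by
      filter_upwards [isOpen_compl_singleton.mem_nhds hz] with w hw using hg.map_smul t ht w hw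
    have h2 := h1.fderiv_eq (𝕜 := ℝ)
    rw [fderiv_comp_smul, fderiv_fun_const_smul (hg.hasFDerivAt hz).differentiableAt] at h2
    rw [pow_succ', mul_smul, ← h2, smul_smul, inv_mul_cancel₀ ht.ne', one_smul]

theorem exists_norm_le [FiniteDimensional ℝ X] (hg : IsHomogeneousKernel q g) :
    ∃ C, 0 ≤ C ∧ ∀ z ≠ 0, ‖g z‖ ≤ C * ‖z‖⁻¹ ^ q := by
  have : ProperSpace X := FiniteDimensional.proper ℝ X
  obtain ⟨C, hC⟩ := (isCompact_sphere (0 : X) 1).exists_bound_of_continuousOn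
    (hg.continuousOn.mono fun z hz => by
      rintro rfl
      simp at hz)
  -- The unit sphere is empty if `X` is trivial, so `C` alone need not be nonnegative.
  refine ⟨max C 0, le_max_right _ _, fun z hz => ?_⟩
  have hz' : 0 < ‖z‖ := norm_pos_iff.2 hz
  have h := hg.map_smul ‖z‖ hz' (‖z‖⁻¹ • z) (smul_ne_zero (inv_ne_zero hz'.ne') hz)
  rw [smul_smul, mul_inv_cancel₀ hz'.ne', one_smul] at h
  rw [h, norm_smul, Real.norm_of_nonneg (by positivity), mul_comm]
  refine mul_le_mul_of_nonneg_right ((hC _ ?_).trans (le_max_left _ _)) (by positivity)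
  rw [mem_sphere_zero_iff_norm, norm_smul, norm_inv, norm_norm, inv_mul_cancel₀ hz'.ne']

end IsHomogeneousKernel

/-! ### Potentials with homogeneous kernels -/

section Potential

variable {m : ℕ} {V F : Type} [NormedAddCommGroup V] [NormedSpace ℝ V]
  [NormedAddCommGroup F] [NormedSpace ℝ F] {q : ℕ}

/-- The weight `(1 + ‖x‖)^(-(m+1))` on `R^m`. -/
noncomputable def weight {m : ℕ} (x : E m) : ℝ := (1 + ‖x‖)⁻¹ ^ (m + 1)

theorem weight_nonneg (x : E m) : 0 ≤ weight x := by unfold weight; positivity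

theorem weight_le_one (x : E m) : weight x ≤ 1 :=
  pow_le_one₀ (by positivity) (inv_le_one_of_one_le₀ (by linarith [norm_nonneg x]))

@[fun_prop]
theorem continuous_weight : Continuous (weight : E m → ℝ) := by
  unfold weight
  refine Continuous.pow (Continuous.inv₀ (by fun_prop) fun x => ?_) _
  positivity

theorem integrable_weight : Integrable (weight : E m → ℝ) := by
  have h := integrable_one_add_norm (E := E m) (μ := volume) (r := (m + 1 : ℕ)) (by simp)
  refine h.congr (Eventually.of_forall fun x => ?_)
  simp only [weight]
  rw [Real.rpow_neg (by positivity), Real.rpow_natCast, inv_pow]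

/-- The integral `∫ g (y - x) (φ x) dx` over the boundary. -/
noncomputable def potential (g : E (m + 1) → V →L[ℝ] F) (φ : E m → V) (y : E (m + 1)) : F :=
  ∫ x : E m, g (y - pt x 0) (φ x)

variable {g : E (m + 1) → V →L[ℝ] F} {φ : E m → V}

/-- The domination behind integrability, differentiation under the integral and the boundary limits.
Any `q ≥ m + 1` will do, because `(1 + ‖x‖)⁻¹ ≤ 1`. -/
theorem IsHomogeneousKernel.exists_ball_norm_le {W : Type*} [NormedAddCommGroup W] [NormedSpace ℝ W]
    {k : E (m + 1) → W} (hk : IsHomogeneousKernel q k) (hq : m + 1 ≤ q) {y₀ : E (m + 1)}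
    (hy₀ : y₀ ∈ upperHalf m) :
    ∃ ε > 0, ∃ C, 0 ≤ C ∧ ∀ y ∈ Metric.ball y₀ ε, y ∈ upperHalf m ∧
      ∀ x : E m, ‖k (y - pt x 0)‖ ≤ C * weight x := by
  obtain ⟨ε, hε, c, hc, h⟩ := exists_ball_norm_sub_pt hy₀
  obtain ⟨C, hC, hk⟩ := hk.exists_norm_le
  refine ⟨ε, hε, C * c ^ q, by positivity, fun y hy => ⟨(h y hy).1, fun x => ?_⟩⟩
  refine (hk _ (sub_pt_ne_zero (h y hy).1 x)).trans ?_
  rw [mul_assoc]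
  refine mul_le_mul_of_nonneg_left ?_ hC
  refine (pow_le_pow_left₀ (by positivity) ((h y hy).2 x) q).trans ?_
  rw [mul_pow]
  refine mul_le_mul_of_nonneg_left ?_ (by positivity)
  exact pow_le_pow_of_le_one (by positivity)
    (inv_le_one_of_one_le₀ (by linarith [norm_nonneg x])) hq

theorem IsHomogeneousKernel.continuous_sub_pt {W : Type*} [NormedAddCommGroup W] [NormedSpace ℝ W]
    {k : E (m + 1) → W} (hk : IsHomogeneousKernel q k) {y : E (m + 1)} (hy : y ∈ upperHalf m) :
    Continuous fun x : E m => k (y - pt x 0) :=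
  hk.continuousOn.comp_continuous (by fun_prop) fun x => sub_pt_ne_zero hy x

theorem aestronglyMeasurable_potential (hg : IsHomogeneousKernel q g)
    (hφ : AEStronglyMeasurable φ) {y : E (m + 1)} (hy : y ∈ upperHalf m) :
    AEStronglyMeasurable fun x : E m => g (y - pt x 0) (φ x) :=
  (ContinuousLinearMap.id ℝ (V →L[ℝ] F)).aestronglyMeasurable_comp₂
    (hg.continuous_sub_pt hy).aestronglyMeasurable hφ

theorem integrable_potential (hg : IsHomogeneousKernel q g) (hq : m + 1 ≤ q)
    (hφ : AEStronglyMeasurable φ) (hφ' : Integrable fun x => weight x * ‖φ x‖)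
    {y : E (m + 1)} (hy : y ∈ upperHalf m) :
    Integrable fun x : E m => g (y - pt x 0) (φ x) := by
  obtain ⟨ε, hε, C, hC, h⟩ := hg.exists_ball_norm_le hq hy
  refine (hφ'.const_mul C).mono' (aestronglyMeasurable_potential hg hφ hy)
    (Eventually.of_forall fun x => ?_)
  rw [← mul_assoc]
  exact (ContinuousLinearMap.le_opNorm _ _).trans
    (mul_le_mul_of_nonneg_right ((h y (Metric.mem_ball_self hε)).2 x) (norm_nonneg _))

/-- The derivative of a kernel, as an operator-valued kernel. -/
noncomputable def derivKernel (g : E (m + 1) → V →L[ℝ] F) (z : E (m + 1)) :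
    V →L[ℝ] E (m + 1) →L[ℝ] F :=
  (fderiv ℝ g z).flip

/-- The `flip` puts the density slot first, so that the derivative of a potential is again a
potential and can be differentiated in turn. -/
theorem IsHomogeneousKernel.derivKernel (hg : IsHomogeneousKernel q g) :
    IsHomogeneousKernel (q + 1) (derivKernel g) :=
  hg.fderiv_right.clm_comp (W' := V →L[ℝ] E (m + 1) →L[ℝ] F)
    (ContinuousLinearMap.flipₗᵢ ℝ (E (m + 1)) V F).toContinuousLinearEquiv.toContinuousLinearMap

theorem hasFDerivAt_potential (hg : IsHomogeneousKernel q g) (hq : m + 1 ≤ q)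
    (hφ : AEStronglyMeasurable φ) (hφ' : Integrable fun x => weight x * ‖φ x‖)
    {y : E (m + 1)} (hy : y ∈ upperHalf m) :
    HasFDerivAt (potential g φ) (potential (derivKernel g) φ y) y := by
  have hg' := hg.derivKernel
  obtain ⟨ε, hε, C, hC, h⟩ := hg'.exists_ball_norm_le (hq.trans q.le_succ) hy
  refine hasFDerivAt_integral_of_dominated_of_fderiv_le (s := Metric.ball y ε)
    (F := fun y x => g (y - pt x 0) (φ x))
    (F' := fun y x => HyperbolicClifford.derivKernel g (y - pt x 0) (φ x))
    (bound := fun x => C * (weight x * ‖φ x‖))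
    (Metric.ball_mem_nhds y hε) ?_ (integrable_potential hg hq hφ hφ' hy)
    (aestronglyMeasurable_potential hg' hφ hy) ?_ (hφ'.const_mul C) ?_
  · filter_upwards [(isOpen_upperHalf m).mem_nhds hy] with y hy
    exact aestronglyMeasurable_potential hg hφ hy
  · refine Eventually.of_forall fun x z hz => ?_
    rw [← mul_assoc]
    exact (ContinuousLinearMap.le_opNorm _ _).trans
      (mul_le_mul_of_nonneg_right ((h z hz).2 x) (norm_nonneg _))
  · refine Eventually.of_forall fun x z hz => ?_
    have h1 := (hg.hasFDerivAt (sub_pt_ne_zero (h z hz).1 x)).comp z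
      ((hasFDerivAt_id z).sub_const (pt x 0))
    have h2 := h1.clm_apply (hasFDerivAt_const (φ x) z)
    refine h2.congr_fderiv ?_
    ext v
    simp [HyperbolicClifford.derivKernel]

/-- The target space, `q` and `g` are quantified inside the induction: each derivative replaces `F`
by `E (m + 1) →L[ℝ] F` and `q` by `q + 1`. -/
theorem contDiffOn_potential (k : ℕ) : ∀ {F : Type} [NormedAddCommGroup F] [NormedSpace ℝ F]
    {q : ℕ} {g : E (m + 1) → V →L[ℝ] F}, IsHomogeneousKernel q g → m + 1 ≤ q →
    AEStronglyMeasurable φ → Integrable (fun x => weight x * ‖φ x‖) →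
    ContDiffOn ℝ k (potential g φ) (upperHalf m) := by
  induction k with
  | zero =>
    intro F _ _ q g hg hq hφ hφ'
    exact contDiffOn_zero.2 fun y hy =>
      (hasFDerivAt_potential hg hq hφ hφ' hy).continuousAt.continuousWithinAt
  | succ k ih =>
    intro F _ _ q g hg hq hφ hφ'
    have h : ContDiffOn ℝ ((k : WithTop ℕ∞) + 1) (potential g φ) (upperHalf m) := by
      refine (contDiffOn_succ_iff_fderiv_of_isOpen (isOpen_upperHalf m)).2 ⟨fun y hy =>
        (hasFDerivAt_potential hg hq hφ hφ' hy).differentiableAt.differentiableWithinAt,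
        -- The analyticity clause concerns only the smoothness order `ω`, whereas `k` is finite.
        fun h => absurd h (WithTop.coe_ne_top (a := (k : ℕ∞))), ?_⟩
      exact (ih hg.derivKernel (hq.trans q.le_succ) hφ hφ').congr fun y hy =>
        (hasFDerivAt_potential hg hq hφ hφ' hy).fderiv
    exact_mod_cast h

end Potential

/-! ### Densities in `L^p` -/

section Lp

variable {m : ℕ} {V : Type*} [NormedAddCommGroup V] {φ : E m → V} {p : ℝ≥0∞}

/-- From `t ≤ 1 + t^p` for `t ≥ 0` and `p ≥ 1`: an `L^p` density is controlled by a bounded part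
plus an integrable part, which replaces Hölder's inequality below. -/
theorem exists_integrable_norm_le (hφ : MemLp φ p volume) (hp₁ : 1 ≤ p) (hp : p < ⊤) :
    ∃ G : E m → ℝ, Integrable G ∧ ∀ x, ‖φ x‖ ≤ 1 + G x := by
  refine ⟨_, hφ.integrable_norm_rpow (zero_lt_one.trans_le hp₁).ne' hp.ne, fun x => ?_⟩
  have h1 : 1 ≤ p.toReal := by simpa using ENNReal.toReal_mono hp.ne hp₁
  rcases le_total ‖φ x‖ 1 with h | h
  · have : 0 ≤ ‖φ x‖ ^ p.toReal := by positivity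
    linarith
  · have := Real.rpow_le_rpow_of_exponent_le h h1
    rw [Real.rpow_one] at this
    linarith

theorem integrable_weight_mul_norm (hφ : MemLp φ p volume) (hp₁ : 1 ≤ p) (hp : p < ⊤) :
    Integrable fun x => weight x * ‖φ x‖ := by
  obtain ⟨G, hG, h⟩ := exists_integrable_norm_le hφ hp₁ hp
  have hG0 : Integrable fun x => weight x + |G x| := integrable_weight.add hG.abs
  refine hG0.mono' (continuous_weight.aestronglyMeasurable.mul hφ.1.norm)
    (Eventually.of_forall fun x => ?_)
  have h0 := weight_nonneg x
  have h1 := weight_le_one x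
  rw [norm_mul, norm_norm, Real.norm_of_nonneg h0]
  calc weight x * ‖φ x‖ ≤ weight x * (1 + |G x|) :=
        mul_le_mul_of_nonneg_left ((h x).trans (by linarith [le_abs_self (G x)])) h0
    _ ≤ weight x + |G x| := by nlinarith [abs_nonneg (G x)]

end Lp

/-! ### Boundary limits at Lebesgue points -/

section Limit

variable {m : ℕ}

/-- The mean of `ψ` over the ball of radius `r` about `0`, up to a constant factor. -/
noncomputable def ballMean (ψ : E m → ℝ) (r : ℝ) : ℝ := (r ^ m)⁻¹ * ∫ x in Metric.closedBall 0 r, ψ x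

theorem ballMean_nonneg {ψ : E m → ℝ} (h0 : ∀ x, 0 ≤ ψ x) {r : ℝ} (hr : 0 ≤ r) :
    0 ≤ ballMean ψ r :=
  mul_nonneg (by positivity) (integral_nonneg h0)

/-- Choose `n` with `2^n ≤ 1 + ‖u‖ < 2^(n+1)`. -/
theorem exists_weight_le (u : E m) :
    ∃ n : ℕ, ‖u‖ ≤ 2 ^ (n + 1) ∧ weight u ≤ ((2 : ℝ) ^ n)⁻¹ ^ (m + 1) := by
  obtain ⟨n, h1, h2⟩ := exists_nat_pow_near (x := 1 + ‖u‖) (y := (2 : ℝ))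
    (by linarith [norm_nonneg u]) one_lt_two
  refine ⟨n, by linarith, ?_⟩
  exact pow_le_pow_left₀ (by positivity) (inv_anti₀ (by positivity) h1) _

/-- The weight is at most the sum over `n` of `2^(-n(m+1))` times the indicator of the ball of
radius `2^(n+1)`. After rescaling by `s`, the volume of the ball contributes `2^((n+1)m)`, which
leaves the summable factor `2^m 2^(-n)`. -/
theorem norm_integral_le_tsum_ballMean {F : Type*} [NormedAddCommGroup F] [NormedSpace ℝ F]
    {ψ : E m → ℝ} (h0 : ∀ x, 0 ≤ ψ x) (hψ : LocallyIntegrable ψ) {M : ℝ}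
    (hM : ∀ r > 0, ballMean ψ r ≤ M) {f : E m → F} {C s : ℝ} (hC : 0 ≤ C) (hs : 0 < s)
    (hf : ∀ u, ‖f u‖ ≤ C * (weight u * ψ (s • u))) :
    ‖∫ u, f u‖ ≤ C * ∑' n : ℕ, 2 ^ m * ((1 / 2 : ℝ) ^ n * ballMean ψ (s * 2 ^ (n + 1))) := by
  have hterm0 : ∀ n : ℕ, 0 ≤ 2 ^ m * ((1 / 2 : ℝ) ^ n * ballMean ψ (s * 2 ^ (n + 1))) := fun n =>
    mul_nonneg (by positivity)
      (mul_nonneg (by positivity) (ballMean_nonneg h0 (by positivity)))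
  have hsum : Summable fun n : ℕ =>
      2 ^ m * ((1 / 2 : ℝ) ^ n * ballMean ψ (s * 2 ^ (n + 1))) := by
    refine Summable.mul_left _ (Summable.of_nonneg_of_le (fun n => mul_nonneg (by positivity)
      (ballMean_nonneg h0 (by positivity))) (fun n => ?_)
      ((summable_geometric_two).mul_right M))
    exact mul_le_mul_of_nonneg_left (hM _ (by positivity)) (by positivity)
  set B : ℕ → Set (E m) := fun n => Metric.closedBall 0 (s * 2 ^ (n + 1)) with hB
  set h : ℕ → E m → ℝ := fun n u =>
    ((2 : ℝ) ^ n)⁻¹ ^ (m + 1) * (B n).indicator ψ (s • u) with hh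
  have hh0 : ∀ n u, 0 ≤ h n u := fun n u =>
    mul_nonneg (by positivity) (Set.indicator_nonneg (fun x _ => h0 x) _)
  have hint : ∀ n, Integrable (h n) := fun n =>
    (((hψ.integrableOn_isCompact (isCompact_closedBall _ _)).integrable_indicator
      measurableSet_closedBall).comp_smul hs.ne').const_mul _
  have hval : ∀ n, ∫ u, h n u =
      2 ^ m * ((1 / 2 : ℝ) ^ n * ballMean ψ (s * 2 ^ (n + 1))) := fun n => by
    rw [hh, integral_const_mul, Measure.integral_comp_smul_of_nonneg _ _ _ (hR := hs.le),
      integral_indicator measurableSet_closedBall, ballMean, finrank_euclideanSpace,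
      Fintype.card_fin, smul_eq_mul]
    have : ((1 : ℝ) / 2) ^ n = (2 ^ n)⁻¹ := by rw [one_div, inv_pow]
    rw [this]
    set J := ∫ x in Metric.closedBall (0 : E m) (s * 2 ^ (n + 1)), ψ x
    change ((2 : ℝ) ^ n)⁻¹ ^ (m + 1) * ((s ^ m)⁻¹ * J) = _
    rw [mul_pow, pow_succ' (2 : ℝ) n, mul_pow, pow_succ, inv_pow]
    field_simp
  have hpt : ∀ u, ENNReal.ofReal (weight u * ψ (s • u)) ≤ ∑' n, ENNReal.ofReal (h n u) := by
    intro u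
    obtain ⟨n, hn, hw⟩ := exists_weight_le u
    refine le_trans ?_ (ENNReal.le_tsum n)
    refine ENNReal.ofReal_le_ofReal ?_
    have hmem : s • u ∈ B n := by
      rw [hB, mem_closedBall_zero_iff, norm_smul, Real.norm_of_nonneg hs.le]
      exact mul_le_mul_of_nonneg_left hn hs.le
    simp only [hh]
    rw [Set.indicator_of_mem hmem]
    exact mul_le_mul_of_nonneg_right hw (h0 _)
  -- In `ℝ≥0∞` the sum and the integral may be exchanged freely, and no measurability of `f` is
  -- needed.
  refine (norm_integral_le_lintegral_norm f).trans ?_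
  rw [← ENNReal.toReal_ofReal (mul_nonneg hC (tsum_nonneg hterm0))]
  refine ENNReal.toReal_mono ENNReal.ofReal_ne_top ?_
  rw [ENNReal.ofReal_mul hC, ENNReal.ofReal_tsum_of_nonneg hterm0 hsum]
  calc ∫⁻ u, ENNReal.ofReal ‖f u‖
      ≤ ∫⁻ u, ENNReal.ofReal C * ∑' n, ENNReal.ofReal (h n u) := by
        refine lintegral_mono fun u => ?_
        refine (ENNReal.ofReal_le_ofReal (hf u)).trans ?_
        rw [ENNReal.ofReal_mul hC]
        gcongr
        exact hpt u
    _ = ENNReal.ofReal C * ∑' n, ∫⁻ u, ENNReal.ofReal (h n u) := by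
        rw [lintegral_const_mul' _ _ ENNReal.ofReal_ne_top,
          lintegral_tsum fun n => (hint n).aestronglyMeasurable.aemeasurable.ennreal_ofReal]
    _ = _ := by
        congr 2
        ext n
        rw [← hval n, ofReal_integral_eq_lintegral_ofReal (hint n)
          (Eventually.of_forall (hh0 n))]

/-- Dominated convergence for series: each mean tends to `0`, and the uniform bound `M` leaves a
geometric majorant. -/
theorem tendsto_tsum_ballMean {ψ : E m → ℝ} (h0 : ∀ x, 0 ≤ ψ x) {M : ℝ}
    (hM : ∀ r > 0, ballMean ψ r ≤ M) (hψ : Tendsto (ballMean ψ) (𝓝[>] 0) (𝓝 0)) :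
    Tendsto (fun s => ∑' n : ℕ, 2 ^ m * ((1 / 2 : ℝ) ^ n * ballMean ψ (s * 2 ^ (n + 1))))
      (𝓝[>] 0) (𝓝 0) := by
  have h := tendsto_tsum_of_dominated_convergence (𝓕 := 𝓝[>] (0 : ℝ)) (g := fun _ : ℕ => (0 : ℝ))
    (f := fun s (n : ℕ) => 2 ^ m * ((1 / 2 : ℝ) ^ n * ballMean ψ (s * 2 ^ (n + 1))))
    (bound := fun n => 2 ^ m * ((1 / 2 : ℝ) ^ n * M))
    (((summable_geometric_two).mul_right M).mul_left _) (fun n => ?_) ?_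
  · simpa using h
  · have h1 : Tendsto (fun s : ℝ => s * 2 ^ (n + 1)) (𝓝[>] 0) (𝓝[>] 0) := by
      refine tendsto_nhdsWithin_iff.2 ⟨?_, ?_⟩
      · have : Tendsto (fun s : ℝ => s * 2 ^ (n + 1)) (𝓝 0) (𝓝 (0 * 2 ^ (n + 1))) :=
          (continuous_mul_const _).tendsto 0
        rw [zero_mul] at this
        exact this.mono_left nhdsWithin_le_nhds
      · filter_upwards [self_mem_nhdsWithin] with s hs
        exact mul_pos (Set.mem_Ioi.1 hs) (by positivity)
    simpa using ((hψ.comp h1).const_mul ((1 / 2 : ℝ) ^ n)).const_mul (2 ^ m)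
  · filter_upwards [self_mem_nhdsWithin] with s hs n
    have hs : 0 < s := hs
    have h2 := ballMean_nonneg h0 (r := s * 2 ^ (n + 1)) (by positivity)
    rw [Real.norm_of_nonneg (by positivity)]
    have := hM (s * 2 ^ (n + 1)) (by positivity)
    gcongr

variable {V : Type} [NormedAddCommGroup V] {φ : E m → V} {p : ℝ≥0∞}

theorem measureReal_closedBall_eq (x : E m) {r : ℝ} (hr : 0 ≤ r) :
    (volume : Measure (E m)).real (Metric.closedBall x r) =
      r ^ m * (volume : Measure (E m)).real (Metric.ball 0 1) := by
  rw [Measure.real, Measure.addHaar_closedBall _ _ hr, ENNReal.toReal_mul,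
    ENNReal.toReal_ofReal (by positivity), finrank_euclideanSpace, Fintype.card_fin, Measure.real]

/-- Lebesgue's differentiation theorem, after the substitution `x = y' - v`; `ballMean` differs from
the average by the volume of the unit ball. -/
theorem ae_tendsto_ballMean (hφ : LocallyIntegrable φ) :
    ∀ᵐ y' : E m, Tendsto (ballMean fun v => ‖φ (y' - v) - φ y'‖) (𝓝[>] 0) (𝓝 0) := by
  filter_upwards [IsUnifLocDoublingMeasure.ae_tendsto_average_norm_sub volume hφ 1] with y' hy'
  have h := hy' (l := 𝓝[>] (0 : ℝ)) (fun _ => y') id tendsto_id (by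
    filter_upwards [self_mem_nhdsWithin] with r hr
    simpa using le_of_lt hr)
  have h := h.const_mul ((volume : Measure (E m)).real (Metric.ball 0 1))
  rw [mul_zero] at h
  refine h.congr' ?_
  filter_upwards [self_mem_nhdsWithin] with r hr
  have hr : 0 < r := hr
  have hb : (volume : Measure (E m)).real (Metric.ball 0 1) ≠ 0 :=
    (measureReal_ne_zero_iff (by finiteness)).2 (Metric.measure_ball_pos _ _ one_pos).ne'
  rw [setAverage_eq, ballMean, id, measureReal_closedBall_eq _ hr.le, smul_eq_mul, mul_inv, mul_assoc, mul_left_comm,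
    mul_inv_cancel_left₀ hb]
  congr 1
  rw [← integral_indicator measurableSet_closedBall, ← integral_indicator measurableSet_closedBall,
    ← integral_sub_left_eq_self _ _ y']
  refine integral_congr_ae (Eventually.of_forall fun v => ?_)
  simp only [Set.indicator, mem_closedBall_iff_norm, sub_sub_cancel_left, norm_neg, sub_zero]

/-- Small radii are bounded by the Lebesgue point property. For `r ≥ δ`, the oscillation is at most
`K + |G (y' - v)|`: the constant has bounded mean, and the integrable part contributes at most
`δ^(-m) ∫ |G|`. -/
theorem exists_ballMean_le {y' : E m} (hφ : MemLp φ p volume) (hp₁ : 1 ≤ p) (hp : p < ⊤)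
    (hy' : Tendsto (ballMean fun v => ‖φ (y' - v) - φ y'‖) (𝓝[>] 0) (𝓝 0)) :
    ∃ M, ∀ r > 0, ballMean (fun v => ‖φ (y' - v) - φ y'‖) r ≤ M := by
  obtain ⟨G, hG, hφG⟩ := exists_integrable_norm_le hφ hp₁ hp
  obtain ⟨δ, hδ, h⟩ := mem_nhdsGT_iff_exists_Ioo_subset.1 (hy'.eventually (gt_mem_nhds one_pos))
  have hδ : 0 < δ := hδ
  set K := 1 + ‖φ y'‖
  set I := ∫ v, |G v|
  have hI : 0 ≤ I := integral_nonneg fun v => abs_nonneg _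
  set b := (volume : Measure (E m)).real (Metric.ball 0 1)
  refine ⟨max 1 (K * b + (δ ^ m)⁻¹ * I), fun r hr => ?_⟩
  rcases lt_or_ge r δ with hrδ | hrδ
  · exact (h ⟨hr, hrδ⟩).le.trans (le_max_left _ _)
  refine le_trans ?_ (le_max_right _ _)
  have hGy : Integrable fun v => |G (y' - v)| := hG.abs.comp_sub_left y'
  have : IsFiniteMeasure ((volume : Measure (E m)).restrict (Metric.closedBall 0 r)) :=
    isFiniteMeasure_restrict.2 measure_closedBall_lt_top.ne
  have h1 : ∫ v in Metric.closedBall (0 : E m) r, ‖φ (y' - v) - φ y'‖ ≤ r ^ m * b * K + I := by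
    calc ∫ v in Metric.closedBall (0 : E m) r, ‖φ (y' - v) - φ y'‖
        ≤ ∫ v in Metric.closedBall (0 : E m) r, (K + |G (y' - v)|) := by
          refine integral_mono_of_nonneg (Eventually.of_forall fun v => norm_nonneg _)
            ((integrable_const _).add hGy.integrableOn)
            (Eventually.of_forall fun v => ?_)
          have h2 := norm_sub_le (φ (y' - v)) (φ y')
          have h3 := hφG (y' - v)
          have h4 := le_abs_self (G (y' - v))
          simp only [K]
          linarith
      _ = r ^ m * b * K + ∫ v in Metric.closedBall (0 : E m) r, |G (y' - v)| := by
          rw [integral_add (integrable_const _) hGy.integrableOn,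
            setIntegral_const, measureReal_closedBall_eq _ hr.le, smul_eq_mul]
      _ ≤ r ^ m * b * K + I := by
          gcongr
          refine (setIntegral_le_integral hGy (Eventually.of_forall fun v => abs_nonneg _)).trans ?_
          rw [integral_sub_left_eq_self (fun v => |G v|)]
  rw [ballMean]
  calc (r ^ m)⁻¹ * ∫ v in Metric.closedBall (0 : E m) r, ‖φ (y' - v) - φ y'‖
      ≤ (r ^ m)⁻¹ * (r ^ m * b * K + I) := by gcongr
    _ = K * b + (r ^ m)⁻¹ * I := by
        have : r ^ m ≠ 0 := by positivity
        field_simp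
    _ ≤ K * b + (δ ^ m)⁻¹ * I := by gcongr

variable [NormedSpace ℝ V] {F : Type} [NormedAddCommGroup F] [NormedSpace ℝ F] {q : ℕ}
  {g : E (m + 1) → V →L[ℝ] F}

theorem pt_mem_upperHalf (x : E m) {s : ℝ} (hs : 0 < s) : pt x s ∈ upperHalf m := by
  simpa [upperHalf] using hs

theorem weight_neg (u : E m) : weight (-u) = weight u := by rw [weight, weight, norm_neg]

theorem IsHomogeneousKernel.map_pt_smul {W : Type*} [NormedAddCommGroup W] [NormedSpace ℝ W]
    {k : E (m + 1) → W} (hk : IsHomogeneousKernel q k) (u : E m) {s : ℝ} (hs : 0 < s) :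
    k (pt (s • u) s) = s⁻¹ ^ q • k (pt u 1) := by
  rw [← hk.map_smul s hs, smul_pt, mul_one]
  intro h
  have := pt_last u 1
  rw [h] at this
  simp at this

theorem integrable_kernel_pt_one (hg : IsHomogeneousKernel q g) (hq : m + 1 ≤ q) (c : V) :
    Integrable fun u : E m => g (pt u 1) c := by
  have h := integrable_potential hg hq (φ := fun _ => c) aestronglyMeasurable_const
    (integrable_weight.mul_const _) (pt_mem_upperHalf (0 : E m) one_pos)
  simpa [pt_sub_pt] using h.comp_neg

/-- Substitute `x = y' - s u`: the Jacobian gives `s^m` and homogeneity gives `s^(-q)`. -/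
theorem potential_pt (hg : IsHomogeneousKernel q g) (y' : E m) {s : ℝ} (hs : 0 < s) :
    potential g φ (pt y' s) = (s ^ m * s⁻¹ ^ q) • ∫ u, g (pt u 1) (φ (y' - s • u)) := by
  have h := Measure.integral_comp_smul_of_nonneg (volume : Measure (E m))
    (fun w => g (pt w s) (φ (y' - w))) s (hR := hs.le)
  simp only [hg.map_pt_smul _ hs, smul_apply] at h
  rw [integral_smul, finrank_euclideanSpace, Fintype.card_fin, eq_inv_smul_iff₀ (by positivity),
    smul_smul] at h
  rw [h, potential, ← integral_sub_left_eq_self _ _ y']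
  simp [pt_sub_pt]

theorem integrable_kernel_pt_one_comp (hg : IsHomogeneousKernel q g) (hq : m + 1 ≤ q)
    (hφ : AEStronglyMeasurable φ) (hφ' : Integrable fun x => weight x * ‖φ x‖)
    (y' : E m) {s : ℝ} (hs : 0 < s) :
    Integrable fun u : E m => g (pt u 1) (φ (y' - s • u)) := by
  have h := ((integrable_potential hg hq hφ hφ' (pt_mem_upperHalf y' hs)).comp_sub_left
    y').comp_smul hs.ne'
  simp only [pt_sub_pt, sub_sub_cancel, sub_zero, hg.map_pt_smul _ hs,
    smul_apply] at h
  exact (integrable_fun_smul_iff (by positivity) _).1 h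

/-- Boundary values of potentials: the rescaled kernels are an approximate identity. -/
theorem ae_tendsto_potential (hg : IsHomogeneousKernel q g) (hq : m + 1 ≤ q)
    (hφ : MemLp φ p volume) (hp₁ : 1 ≤ p) (hp : p < ⊤) :
    ∀ᵐ y' : E m, Tendsto (fun s : ℝ => s ^ (q - m) • potential g φ (pt y' s)) (𝓝[>] 0)
      (𝓝 (∫ u, g (pt u 1) (φ y'))) := by
  obtain ⟨ε, hε, C, hC, hgC⟩ := hg.exists_ball_norm_le hq (pt_mem_upperHalf (0 : E m) one_pos)
  have hgC : ∀ u : E m, ‖g (pt u 1)‖ ≤ C * weight u := fun u => by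
    -- The bound is read off at the single point `(0, 1)`, since `(0, 1) - (-u, 0) = (u, 1)`.
    simpa [pt_sub_pt, weight_neg] using (hgC _ (Metric.mem_ball_self hε)).2 (-u)
  have hφi := integrable_weight_mul_norm hφ hp₁ hp
  filter_upwards [ae_tendsto_ballMean (hφ.locallyIntegrable hp₁)] with y' hy'
  obtain ⟨M, hM⟩ := exists_ballMean_le hφ hp₁ hp hy'
  have hloc : LocallyIntegrable fun v => ‖φ (y' - v) - φ y'‖ := by
    have h1 : MemLp (fun v => φ (y' - v)) p volume :=
      hφ.comp_measurePreserving (Measure.measurePreserving_sub_left volume y')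
    exact fun x => ((h1.locallyIntegrable hp₁).sub (locallyIntegrable_const _) x).norm
  have ht := (tendsto_tsum_ballMean (fun v => norm_nonneg _) hM hy').const_mul C
  rw [mul_zero] at ht
  rw [tendsto_iff_norm_sub_tendsto_zero]
  refine squeeze_zero' (Eventually.of_forall fun _ => norm_nonneg _) ?_ ht
  filter_upwards [self_mem_nhdsWithin] with s hs
  have hs : 0 < s := hs
  have hpow : s ^ (q - m) * (s ^ m * s⁻¹ ^ q) = 1 := by
    rw [← mul_assoc, ← pow_add, Nat.sub_add_cancel (by omega), ← mul_pow, mul_inv_cancel₀ hs.ne',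
      one_pow]
  rw [potential_pt hg y' hs, smul_smul, hpow, one_smul,
    ← integral_sub (integrable_kernel_pt_one_comp hg hq hφ.1 hφi y' hs)
      (integrable_kernel_pt_one hg hq _)]
  refine norm_integral_le_tsum_ballMean (fun v => norm_nonneg _) hloc hM hC hs fun u => ?_
  rw [← map_sub, ← mul_assoc]
  exact (ContinuousLinearMap.le_opNorm _ _).trans
    (mul_le_mul_of_nonneg_right (hgC u) (norm_nonneg _))

end Limit

/-! ### The mass of the Poisson kernel -/

section Mass

variable {m : ℕ}

theorem sphereArea_succ (m : ℕ) :
    sphereArea (m + 1) = 2 * √Real.pi ^ (m + 1) / Real.Gamma (m / 2 + 1 / 2) := by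
  rw [sphereArea, Measure.toSphere_real_apply_univ, Measure.real, EuclideanSpace.volume_ball,
    finrank_euclideanSpace, Fintype.card_fin, ENNReal.ofReal_one, one_pow, one_mul,
    ENNReal.toReal_ofReal (by positivity)]
  have h : ((m + 1 : ℕ) : ℝ) / 2 = m / 2 + 1 / 2 := by push_cast; ring
  rw [h, Real.Gamma_add_one (by positivity)]
  have h2 : Real.Gamma ((m : ℝ) / 2 + 1 / 2) ≠ 0 := (Real.Gamma_pos_of_pos (by positivity)).ne'
  push_cast
  field_simp

theorem sphereArea_pos (m : ℕ) : 0 < sphereArea (m + 1) := by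
  rw [sphereArea_succ]
  have := Real.Gamma_pos_of_pos (s := (m : ℝ) / 2 + 1 / 2) (by positivity)
  positivity

theorem integrable_inv_one_add_norm_sq_pow (hm : 0 < m) :
    Integrable fun x : E m => ((1 + ‖x‖ ^ 2) ^ m)⁻¹ := by
  have h := integrable_rpow_neg_one_add_norm_sq (E := E m) (μ := volume) (r := 2 * m) (by
    rw [finrank_euclideanSpace, Fintype.card_fin]
    have : (0 : ℝ) < m := by exact_mod_cast hm
    linarith)
  refine h.congr (Eventually.of_forall fun x => ?_)
  have h1 : -(2 * (m : ℝ)) / 2 = -(m : ℝ) := by ring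
  simp only [h1]
  rw [Real.rpow_neg (by positivity), Real.rpow_natCast]

/-- Write `Γ(m) a^(-m) = ∫ t^(m-1) e^(-a t) dt` with `a = 1 + ‖x‖²` and exchange the integrals. The
Gaussian integral over `x` leaves `π^(m/2) Γ(m/2) / Γ(m)`, and Legendre's duplication formula turns
this into the sphere area. -/
theorem integral_inv_one_add_norm_sq_pow (hm : 0 < m) :
    ∫ x : E m, ((1 + ‖x‖ ^ 2) ^ m)⁻¹ = sphereArea (m + 1) / 2 ^ m := by
  have hm' : (0 : ℝ) < m := by exact_mod_cast hm
  have hΓ := Real.Gamma_pos_of_pos hm'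
  set F : E m → ℝ → ℝ := fun x t => t ^ ((m : ℝ) - 1) * Real.exp (-((1 + ‖x‖ ^ 2) * t)) with hF
  have hF0 : ∀ x, ∀ t ∈ Set.Ioi (0 : ℝ), 0 ≤ F x t := fun x t ht =>
    mul_nonneg (Real.rpow_nonneg (le_of_lt ht) _) (Real.exp_pos _).le
  have hinner : ∀ x, ∫ t in Set.Ioi 0, F x t = ((1 + ‖x‖ ^ 2) ^ m)⁻¹ * Real.Gamma m := fun x => by
    rw [hF, Real.integral_rpow_mul_exp_neg_mul_Ioi hm' (by positivity), Real.rpow_natCast,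
      one_div, inv_pow]
  have hmeas : AEStronglyMeasurable (Function.uncurry F)
      ((volume : Measure (E m)).prod (volume.restrict (Set.Ioi 0))) := by
    refine Measurable.aestronglyMeasurable ?_
    simp only [hF, Function.uncurry_def]
    fun_prop
  have hint : Integrable (Function.uncurry F)
      ((volume : Measure (E m)).prod (volume.restrict (Set.Ioi 0))) := by
    refine (integrable_prod_iff hmeas).2 ⟨Eventually.of_forall fun x => ?_, ?_⟩
    -- The integral of a non-integrable function is `0` by convention, so the nonzero value in
    -- `hinner` forces integrability.
    · refine not_imp_comm.1 integral_undef ?_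
      simp only [Function.uncurry_apply_pair]
      rw [hinner]
      positivity
    · refine ((integrable_inv_one_add_norm_sq_pow hm).mul_const (Real.Gamma m)).congr
        (Eventually.of_forall fun x => ?_)
      simp only [Function.uncurry_apply_pair]
      rw [← hinner]
      exact setIntegral_congr_fun measurableSet_Ioi fun t ht =>
        (Real.norm_of_nonneg (hF0 x t ht)).symm
  have hswap := integral_integral_swap hint
  simp only [hinner] at hswap
  rw [integral_mul_const] at hswap
  have houter : ∀ t ∈ Set.Ioi (0 : ℝ), ∫ x, F x t =
      Real.pi ^ ((m : ℝ) / 2) * (t ^ ((m : ℝ) / 2 - 1) * Real.exp (-(1 * t))) := fun t ht => by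
    have ht : 0 < t := ht
    have h1 : ∀ x, F x t = t ^ ((m : ℝ) - 1) * Real.exp (-(1 * t)) * Real.exp (-t * ‖x‖ ^ 2) :=
      fun x => by
        rw [mul_assoc, ← Real.exp_add]
        simp only [hF]
        ring_nf
    simp only [h1]
    rw [integral_const_mul, GaussianFourier.integral_rexp_neg_mul_sq_norm ht,
      finrank_euclideanSpace, Fintype.card_fin, Real.div_rpow Real.pi_pos.le ht.le]
    have h2 : (m : ℝ) - 1 = (m / 2 - 1) + m / 2 := by ring
    have h3 : t ^ ((m : ℝ) / 2) ≠ 0 := (Real.rpow_pos_of_pos ht _).ne'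
    rw [h2, Real.rpow_add ht]
    field_simp
  rw [setIntegral_congr_fun measurableSet_Ioi houter, integral_const_mul,
    Real.integral_rpow_mul_exp_neg_mul_Ioi (by positivity) one_pos, one_div_one, Real.one_rpow,
    one_mul] at hswap
  have hdup := Real.Gamma_mul_Gamma_add_half ((m : ℝ) / 2)
  have h4 : 2 * ((m : ℝ) / 2) = m := by ring
  have h5 : (2 : ℝ) ^ (1 - (m : ℝ)) = 2 / 2 ^ m := by
    rw [Real.rpow_sub two_pos, Real.rpow_one, Real.rpow_natCast]
  have h6 : Real.pi ^ ((m : ℝ) / 2) = √Real.pi ^ m := by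
    rw [Real.sqrt_eq_rpow, ← Real.rpow_mul_natCast Real.pi_pos.le]
    congr 1
    ring
  rw [h4, h5] at hdup
  rw [h6] at hswap
  have h7 : Real.Gamma ((m : ℝ) / 2 + 1 / 2) ≠ 0 := (Real.Gamma_pos_of_pos (by positivity)).ne'
  rw [← mul_left_inj' hΓ.ne', hswap, sphereArea_succ, ← mul_left_inj' h7, mul_assoc, hdup,
    pow_succ]
  field_simp

end Mass

open scoped InnerProductSpace

/-! ### Linear algebra in `Cl_n` -/

section Algebra

instance finiteDimensional_cl (n : ℕ) : FiniteDimensional ℝ (Cl n) :=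
  Module.Finite.of_basis (clBasis n)

variable {n m : ℕ}

/-- Multiplication of `Cl_n` as a continuous bilinear map. -/
noncomputable def mulCLM (n : ℕ) : Cl n →L[ℝ] Cl n →L[ℝ] Cl n :=
  (LinearMap.mul ℝ (Cl n)).toContinuousBilinearMap

@[simp] theorem mulCLM_apply (A B : Cl n) : mulCLM n A B = A * B := rfl

/-- The inclusion of `R^n` in `Cl_n` as a continuous linear map. -/
noncomputable def vecCLM (n : ℕ) : E n →L[ℝ] Cl n := LinearMap.toContinuousLinearMap vec

@[simp] theorem vecCLM_apply (x : E n) : vecCLM n x = vec x := rfl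

/-- The projection `P` as a continuous linear map. -/
noncomputable def projPCLM (m : ℕ) : Cl (m + 1) →L[ℝ] Cl (m + 1) :=
  LinearMap.toContinuousLinearMap ((1 / 2 : ℝ) • (LinearMap.id + (hat m).toLinearMap))

/-- The map `Q'` as a continuous linear map. -/
noncomputable def projQ'CLM (m : ℕ) : Cl (m + 1) →L[ℝ] Cl (m + 1) :=
  LinearMap.toContinuousLinearMap
    ((-1 / 2 : ℝ) • (LinearMap.mulLeft ℝ (eLast m) ∘ₗ (LinearMap.id - (hat m).toLinearMap)))

theorem eLast_mul_eLast (m : ℕ) : eLast m * eLast m = -1 := gen_mul_self _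

-- Because `e_n² = -1`, the two outer factors in `Q'` collapse to `Q' A = -½ e_n (A - Â)`, the form
-- used in all later computations.
@[simp] theorem projQ'CLM_apply (A : Cl (m + 1)) : projQ'CLM m A = projQ' A := by
  have h : projQ'CLM m A = (-1 / 2 : ℝ) • (eLast m * (A - hat m A)) := rfl
  rw [h, projQ', projQ, mul_smul_comm, smul_mul_assoc, mul_assoc (eLast m), mul_assoc,
    eLast_mul_eLast, mul_neg, mul_one, mul_neg, smul_neg, neg_neg]

/-- The real part as a continuous linear map. -/
noncomputable def reCLM (n : ℕ) : Cl n →L[ℝ] ℝ :=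
  LinearMap.toContinuousLinearMap ((clBasis n).coord ∅)

@[simp] theorem reCLM_apply (A : Cl n) : reCLM n A = re A := rfl

theorem clBasis_empty (n : ℕ) : clBasis n ∅ = 1 := by rw [clBasis_apply]; simp

theorem re_one (n : ℕ) : re (1 : Cl n) = 1 := by
  rw [re, ← clBasis_empty, Module.Basis.repr_self]; simp

theorem gen_mul_gen_eq_clBasis {i j : Fin n} (h : i < j) : gen i * gen j = clBasis n {i, j} := by
  have hs : ({i, j} : Finset (Fin n)).sort = [i, j] := by
    refine List.Perm.eq_of_pairwise' (r := (· ≤ ·)) (Finset.pairwise_sort _ _)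
      (by simpa using h.le) ?_
    refine (List.perm_ext_iff_of_nodup (Finset.sort_nodup _ _) (by simpa using h.ne)).2 ?_
    simp
  rw [clBasis_apply, hs]
  simp

theorem re_gen_mul_gen {i j : Fin n} (h : i < j) : re (gen i * gen j : Cl n) = 0 := by
  rw [re, gen_mul_gen_eq_clBasis h, Module.Basis.repr_self]
  simp

theorem vec_eq_sum (x : E n) : vec x = ∑ j, x j • (gen j : Cl n) := by
  have h := (EuclideanSpace.basisFun (Fin n) ℝ).sum_repr x
  conv_lhs => rw [← h]
  rw [map_sum]
  simp [gen]

theorem vec_mul_vec (x : E n) : vec x * vec x = -algebraMap ℝ (Cl n) (‖x‖ ^ 2) := by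
  rw [CliffordAlgebra.ι_sq_scalar, negForm_apply, map_neg]

/-- For `i < n` the product `e_i e_n` is a basis element other than `1`; only `e_n e_n = -1` has a
real part. -/
theorem re_vec_mul_eLast (x : E (m + 1)) : re (vec x * eLast m) = -x (Fin.last m) := by
  have h : re (vec x * eLast m) =
      reCLM (m + 1) (∑ j, x j • (gen j * eLast m)) := by
    rw [reCLM_apply, vec_eq_sum, Finset.sum_mul]
    simp only [smul_mul_assoc]
  rw [h, map_sum, Fin.sum_univ_castSucc, ← eLast, eLast_mul_eLast]
  simp only [map_smul, map_neg, reCLM_apply, re_one, eLast,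
    re_gen_mul_gen (Fin.castSucc_lt_last _)]
  simp

/-- At `x = 0` both sides vanish, by the conventions for `Ring.inverse` and `⁻¹`. -/
theorem ringInverse_vec (x : E n) : Ring.inverse (vec x : Cl n) = -((‖x‖ ^ 2)⁻¹ • vec x) := by
  rcases eq_or_ne x 0 with rfl | hx
  · simp
  have hx' : ‖x‖ ^ 2 ≠ 0 := pow_ne_zero _ (norm_ne_zero_iff.2 hx)
  have h : (vec x : Cl n) * -((‖x‖ ^ 2)⁻¹ • vec x) = 1 := by
    rw [mul_neg, mul_smul_comm, vec_mul_vec, smul_neg, neg_neg, Algebra.algebraMap_eq_smul_one,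
      smul_smul, inv_mul_cancel₀ hx', one_smul]
  have h' : -((‖x‖ ^ 2)⁻¹ • vec x) * (vec x : Cl n) = 1 := by
    rw [neg_mul, smul_mul_assoc, vec_mul_vec, smul_neg, neg_neg, Algebra.algebraMap_eq_smul_one,
      smul_smul, inv_mul_cancel₀ hx', one_smul]
  exact Ring.inverse_unit ⟨vec x, _, h, h'⟩

theorem hat_hat (A : Cl (m + 1)) : hat m (hat m A) = A := by
  obtain ⟨B, hB, C, hC, rfl⟩ := exists_add_mul_eLast A
  rw [hat_add_mul_eLast hB hC, map_sub, map_mul, hat_of_mem hB, hat_of_mem hC, hat_eLast]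
  rw [mul_neg, sub_neg_eq_add]

theorem hat_projP (A : Cl (m + 1)) : hat m (projP A) = projP A := by
  rw [projP, map_smul, map_add, hat_hat, add_comm (hat m A)]

theorem projP_of_mem {A : Cl (m + 1)} (hA : A ∈ clSub m) : projP A = A := by
  rw [projP, hat_of_mem hA]
  module

theorem projP_algebraMap (r : ℝ) :
    projP (algebraMap ℝ (Cl (m + 1)) r) = algebraMap ℝ (Cl (m + 1)) r :=
  projP_of_mem (algebraMap_mem _ r)

theorem vec_add_hat_vec (x : E (m + 1)) :
    vec x + hat m (vec x) = (2 : ℝ) • (vec x - x (Fin.last m) • eLast m) := by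
  rw [hat_vec, eLast, gen, ← map_smul, ← map_sub, ← map_smul, ← map_add]
  congr 1
  ext i
  by_cases h : i = Fin.last m
  · subst h; simp [reflect]
  · simp [reflect, h, two_mul]

/-- If `Â = A`, the hat of `x e_n A` is `-x̂ e_n A`, so subtracting it leaves `(x + x̂) e_n A = 2 (x
- x_n e_n) e_n A`. -/
theorem projQ'_vec_mul_eLast_mul (x : E (m + 1)) {A : Cl (m + 1)} (hA : hat m A = A) :
    projQ' (vec x * eLast m * A) =
      -(eLast m * (vec x * eLast m * A)) - x (Fin.last m) • (eLast m * A) := by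
  have h : projQ' (vec x * eLast m * A) =
      (-1 / 2 : ℝ) • (eLast m * (vec x * eLast m * A - hat m (vec x * eLast m * A))) := by
    rw [← projQ'CLM_apply]; rfl
  have h2 : vec x * eLast m * A - hat m (vec x * eLast m * A) =
      (vec x + hat m (vec x)) * eLast m * A := by
    rw [map_mul, map_mul, hA, hat_eLast, mul_neg, neg_mul, sub_neg_eq_add, add_mul, add_mul]
  have h3 : eLast m * (eLast m * eLast m * A) = -(eLast m * A) := by
    rw [eLast_mul_eLast, neg_mul, one_mul, mul_neg]
  rw [h, h2, vec_add_hat_vec, smul_mul_assoc, smul_mul_assoc, mul_smul_comm, smul_smul, sub_mul,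
    sub_mul, smul_mul_assoc, smul_mul_assoc, mul_sub, mul_smul_comm, h3]
  module

theorem sum_gen_mul_vec_mul (A : Cl n) :
    ∑ j : Fin n, gen j * (vec (EuclideanSpace.single j (1 : ℝ)) * A) = -((n : ℝ) • A) := by
  have h : ∀ j : Fin n, gen j * (vec (EuclideanSpace.single j (1 : ℝ)) * A) = -A := fun j => by
    change gen j * (gen j * A) = -A
    rw [← mul_assoc, gen_mul_self, neg_one_mul]
  rw [Finset.sum_congr rfl fun j _ => h j, Finset.sum_const, Finset.card_univ, Fintype.card_fin,
    smul_neg, Nat.cast_smul_eq_nsmul]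

theorem sum_gen_mul_smul (x : E n) (A : Cl n) :
    ∑ j : Fin n, gen j * (x j • A) = vec x * A := by
  rw [vec_eq_sum, Finset.sum_mul]
  simp only [mul_smul_comm, smul_mul_assoc]

end Algebra

/-! ### Negative powers of the norm -/

section NormPow

/-- The function `‖z‖^(-2k)`. -/
noncomputable def normPow {X : Type*} [NormedAddCommGroup X] (k : ℕ) (z : X) : ℝ :=
  (‖z‖ ^ 2)⁻¹ ^ k

theorem normPow_succ_mul {X : Type*} [NormedAddCommGroup X] (k : ℕ) {z : X} (hz : z ≠ 0) :
    normPow (k + 1) z * ‖z‖ ^ 2 = normPow k z := by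
  have : ‖z‖ ^ 2 ≠ 0 := pow_ne_zero _ (norm_ne_zero_iff.2 hz)
  rw [normPow, normPow, pow_succ, mul_assoc, inv_mul_cancel₀ this, mul_one]

variable {X : Type*} [NormedAddCommGroup X] [InnerProductSpace ℝ X]

theorem isHomogeneousKernel_normPow (k : ℕ) :
    IsHomogeneousKernel (2 * k) (normPow k : X → ℝ) where
  contDiffOn := by
    refine ContDiffOn.pow (ContDiffOn.inv (contDiff_norm_sq ℝ).contDiffOn fun z hz => ?_) _
    exact pow_ne_zero _ (norm_ne_zero_iff.2 hz)
  map_smul t ht z hz := by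
    rw [normPow, norm_smul, Real.norm_of_nonneg ht.le, mul_pow, mul_inv, mul_pow, ← inv_pow,
      ← pow_mul, smul_eq_mul, normPow]

theorem hasFDerivAt_normPow (k : ℕ) {z : X} (hz : z ≠ 0) :
    HasFDerivAt (normPow k) ((-(2 * k) * normPow (k + 1) z : ℝ) • innerSL ℝ z) z := by
  have hz' : ‖z‖ ^ 2 ≠ 0 := pow_ne_zero _ (norm_ne_zero_iff.2 hz)
  have h := (((hasDerivAt_inv hz').comp_hasFDerivAt z
    (hasStrictFDerivAt_norm_sq z).hasFDerivAt)).pow k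
  refine h.congr_fderiv ?_
  rcases k with _ | k
  · simp
  ext v
  simp [normPow]
  field_simp
  ring

end NormPow

/-! ### The scalar and the Clifford kernel -/

section Kernels

variable {m : ℕ}

/-- The kernel `‖z‖^(-2k)`, acting on `V` by scalar multiplication. -/
noncomputable def scalarKernel (V : Type) [NormedAddCommGroup V] [NormedSpace ℝ V] (k : ℕ)
    (z : E (m + 1)) : V →L[ℝ] V :=
  normPow k z • ContinuousLinearMap.id ℝ V

theorem isHomogeneousKernel_scalarKernel (V : Type) [NormedAddCommGroup V] [NormedSpace ℝ V]
    (k : ℕ) : IsHomogeneousKernel (2 * k) (scalarKernel V k : E (m + 1) → V →L[ℝ] V) :=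
  (isHomogeneousKernel_normPow k).clm_comp
    (ContinuousLinearMap.toSpanSingleton ℝ (ContinuousLinearMap.id ℝ V))

/-- The kernel `‖z‖^(-2m) z e_n`, acting by left multiplication. -/
noncomputable def cliffordKernel (z : E (m + 1)) : Cl (m + 1) →L[ℝ] Cl (m + 1) :=
  normPow m z • mulCLM (m + 1) (vec z * eLast m)

/-- The linear part `z ↦ z e_n` of the Clifford kernel. -/
noncomputable def vecMulLast (m : ℕ) : E (m + 1) →L[ℝ] Cl (m + 1) →L[ℝ] Cl (m + 1) :=
  mulCLM (m + 1) ∘L (mulCLM (m + 1)).flip (eLast m) ∘L vecCLM (m + 1)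

@[simp] theorem vecMulLast_apply (z : E (m + 1)) (A : Cl (m + 1)) :
    vecMulLast m z A = vec z * eLast m * A := rfl

theorem cliffordKernel_eq (z : E (m + 1)) : cliffordKernel z = normPow m z • vecMulLast m z := rfl

theorem isHomogeneousKernel_cliffordKernel (hm : 0 < m) :
    IsHomogeneousKernel (2 * m - 1)
      (cliffordKernel : E (m + 1) → Cl (m + 1) →L[ℝ] Cl (m + 1)) where
  contDiffOn := (isHomogeneousKernel_normPow m).contDiffOn.smul (vecMulLast m).contDiff.contDiffOn
  map_smul t ht z hz := by
    obtain ⟨k, rfl⟩ := Nat.exists_eq_succ_of_ne_zero hm.ne'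
    rw [cliffordKernel_eq, (isHomogeneousKernel_normPow _).map_smul t ht z hz, map_smul,
      smul_eq_mul, smul_smul, cliffordKernel_eq, smul_smul]
    congr 1
    have h : 2 * k.succ - 1 = 2 * k + 1 := by omega
    have h' : 2 * k.succ = 2 * k + 1 + 1 := by omega
    rw [h, h', pow_succ t⁻¹ (2 * k + 1)]
    field_simp

theorem derivKernel_cliffordKernel {z : E (m + 1)} (hz : z ≠ 0) (A : Cl (m + 1)) (v : E (m + 1)) :
    derivKernel cliffordKernel z A v =
      normPow m z • (vec v * (eLast m * A)) +
        (-(2 * m) * normPow (m + 1) z * ⟪z, v⟫_ℝ) • (vec z * (eLast m * A)) := by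
  have h : HasFDerivAt cliffordKernel _ z :=
    (hasFDerivAt_normPow m hz).smul (vecMulLast m).hasFDerivAt
  rw [derivKernel, h.fderiv]
  simp [mul_assoc]

theorem derivKernel_scalarKernel (k : ℕ) {z : E (m + 1)} (hz : z ≠ 0) (r : ℝ) (v : E (m + 1)) :
    derivKernel (scalarKernel ℝ k) z r v = -(2 * k) * normPow (k + 1) z * ⟪z, v⟫_ℝ * r := by
  have h : HasFDerivAt (scalarKernel ℝ k) _ z :=
    (hasFDerivAt_normPow k hz).smul (hasFDerivAt_const (ContinuousLinearMap.id ℝ ℝ) z)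
  rw [derivKernel, h.fderiv]
  simp

theorem derivKernel_derivKernel_scalarKernel (k : ℕ) {z : E (m + 1)} (hz : z ≠ 0) (r : ℝ)
    (v w : E (m + 1)) :
    derivKernel (derivKernel (scalarKernel ℝ k)) z r v w =
      (-(2 * k) * (-(2 * (k + 1)) * normPow (k + 2) z * ⟪z, v⟫_ℝ * ⟪z, w⟫_ℝ +
        normPow (k + 1) z * ⟪v, w⟫_ℝ)) * r := by
  have hd := ((isHomogeneousKernel_scalarKernel (m := m) ℝ k).derivKernel).hasFDerivAt hz
  have h1 := (hd.clm_apply (hasFDerivAt_const r z)).clm_apply (hasFDerivAt_const w z)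
  have h2 : HasFDerivAt (fun z : E (m + 1) => -(2 * (k : ℝ)) * normPow (k + 1) z * ⟪z, w⟫_ℝ * r)
      _ z := ((((hasFDerivAt_normPow (k + 1) hz).const_mul (-(2 * (k : ℝ)))).mul
      ((hasFDerivAt_id z).inner ℝ (hasFDerivAt_const w z))).mul_const r)
  -- The first derivative has a closed form near `z`; by uniqueness, differentiating that form gives
  -- the second derivative.
  have h3 := h1.unique (h2.congr_of_eventuallyEq (by
    filter_upwards [isOpen_compl_singleton.mem_nhds hz] with z hz
    exact derivKernel_scalarKernel k hz r w))
  have h4 := DFunLike.congr_fun h3 v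
  have h5 : derivKernel (derivKernel (scalarKernel ℝ k)) z r v w =
    fderiv ℝ (derivKernel (scalarKernel ℝ k)) z v r w := rfl
  rw [h5]
  simp at h4
  rw [h4]
  ring

/-- The sum of `e_j e_j` gives `-(m + 1)`, and differentiating the power of the norm gives `2m`
through `z z = -‖z‖²`; the total is `m - 1`. -/
theorem sum_gen_mul_derivKernel {z : E (m + 1)} (hz : z ≠ 0) (A : Cl (m + 1)) :
    ∑ j, gen j * derivKernel cliffordKernel z A (EuclideanSpace.single j 1) =
      ((m : ℝ) - 1) • (eLast m * scalarKernel (Cl (m + 1)) m z A) := by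
  have h1 : ∀ j : Fin (m + 1), ⟪z, EuclideanSpace.single j (1 : ℝ)⟫_ℝ = z j := fun j => by
    simp [EuclideanSpace.inner_single_right]
  simp only [derivKernel_cliffordKernel hz, h1, mul_add, Finset.sum_add_distrib]
  have h2 : ∀ j : Fin (m + 1), gen j *
      ((-(2 * m) * normPow (m + 1) z * z j) • (vec z * (eLast m * A))) =
      (-(2 * m) * normPow (m + 1) z) • (gen j * (z j • (vec z * (eLast m * A)))) := fun j => by
    rw [mul_smul, mul_smul_comm]
  simp only [h2, ← Finset.smul_sum, mul_smul_comm (normPow m z), sum_gen_mul_vec_mul,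
    sum_gen_mul_smul]
  rw [← mul_assoc (vec z), vec_mul_vec, neg_mul (algebraMap ℝ _ _), ← Algebra.smul_def, smul_neg, smul_neg,
    smul_smul (_ * _) (‖z‖ ^ 2), mul_assoc, normPow_succ_mul m hz, scalarKernel, smul_apply,
    ContinuousLinearMap.id_apply, mul_smul_comm]
  push_cast
  module

theorem projQ'_cliffordKernel (z : E (m + 1)) {A : Cl (m + 1)} (hA : hat m A = A) :
    projQ' (cliffordKernel z A) = -(eLast m * cliffordKernel z A) -
      z (Fin.last m) • (eLast m * scalarKernel (Cl (m + 1)) m z A) := by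
  rw [← projQ'CLM_apply, cliffordKernel_eq, scalarKernel, smul_apply, smul_apply, map_smul,
    projQ'CLM_apply, vecMulLast_apply, projQ'_vec_mul_eLast_mul z hA,
    ContinuousLinearMap.id_apply, mul_smul_comm, mul_smul_comm]
  module

theorem sum_derivKernel_derivKernel (k : ℕ) {z : E (m + 1)} (hz : z ≠ 0) (r : ℝ) :
    ∑ j : Fin (m + 1), derivKernel (derivKernel (scalarKernel ℝ k)) z r
      (EuclideanSpace.single j 1) (EuclideanSpace.single j 1) =
      2 * k * (2 * k + 1 - m) * scalarKernel ℝ (k + 1) z r := by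
  have h1 : ∀ j : Fin (m + 1), ⟪z, EuclideanSpace.single j (1 : ℝ)⟫_ℝ = z j := fun j => by
    simp [EuclideanSpace.inner_single_right]
  have h2 : ∀ j : Fin (m + 1), ⟪(EuclideanSpace.single j (1 : ℝ) : E (m + 1)),
      EuclideanSpace.single j (1 : ℝ)⟫_ℝ = 1 := fun j => by simp
  simp only [derivKernel_derivKernel_scalarKernel k hz, h1, h2]
  have h3 : ∀ j : Fin (m + 1), (-(2 * (k : ℝ)) * (-(2 * ((k : ℝ) + 1)) * normPow (k + 2) z * z j * z j +
        normPow (k + 1) z * 1)) * r =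
      2 * k * (2 * (k + 1)) * r * normPow (k + 2) z * z j ^ 2 - 2 * k * r * normPow (k + 1) z :=
    fun j => by ring
  have h4 : normPow (k + 2) z * ∑ j, z j ^ 2 = normPow (k + 1) z := by
    rw [← EuclideanSpace.real_norm_sq_eq]
    exact normPow_succ_mul (k + 1) hz
  rw [Finset.sum_congr rfl fun j _ => h3 j, Finset.sum_sub_distrib, ← Finset.mul_sum, mul_assoc,
    h4, Finset.sum_const, Finset.card_univ, Fintype.card_fin, nsmul_eq_mul, scalarKernel,
    smul_apply, ContinuousLinearMap.id_apply, smul_eq_mul]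
  push_cast
  ring

end Kernels

variable {m : ℕ}

/-! ### The boundary integral as a potential -/

section Potential

variable {V F F' : Type} [NormedAddCommGroup V] [NormedSpace ℝ V]
  [NormedAddCommGroup F] [NormedSpace ℝ F] [CompleteSpace F]
  [NormedAddCommGroup F'] [NormedSpace ℝ F'] [CompleteSpace F'] {q : ℕ}

/-- Carries pointwise kernel identities over to potentials. -/
theorem clm_potential {g : E (m + 1) → V →L[ℝ] F} (hg : IsHomogeneousKernel q g) (hq : m + 1 ≤ q)
    {φ : E m → V} (hφ : AEStronglyMeasurable φ) (hφ' : Integrable fun x => weight x * ‖φ x‖)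
    {y : E (m + 1)} (hy : y ∈ upperHalf m) (L : F →L[ℝ] F') :
    L (potential g φ y) = ∫ x, L (g (y - pt x 0) (φ x)) :=
  (L.integral_comp_comm (integrable_potential hg hq hφ hφ' hy)).symm

end Potential

instance completeSpace_cl (n : ℕ) : CompleteSpace (Cl n) := FiniteDimensional.complete ℝ _

theorem mul_self_inv_mul_inv_sq (r : ℝ) (hm : 0 < m) :
    (r ^ (m - 1) * r ^ (m - 1))⁻¹ * (r ^ 2)⁻¹ = (r ^ 2)⁻¹ ^ m := by
  obtain ⟨k, rfl⟩ : ∃ k, m = k + 1 := ⟨m - 1, by omega⟩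
  rw [Nat.add_sub_cancel, ← mul_inv, inv_pow]
  congr 1
  ring

/-- Both norms agree on the boundary, so the exponents add up to `2 (m - 1) + 2 = 2m`; the minus
sign of the Clifford inverse turns `x - y` into `y - x`. -/
theorem kerE_pt_zero (hm : 0 < m) (x : E m) (y : E (m + 1)) :
    kerE (pt x 0) y = normPow m (y - pt x 0) • vec (y - pt x 0) := by
  have h : ‖pt x 0 - reflect m y‖ = ‖pt x 0 - y‖ := by
    rw [← reflect_pt_zero, ← map_sub, norm_reflect, reflect_pt_zero]
  rw [kerE, h, ringInverse_vec, ← smul_neg, ← map_neg, neg_sub, smul_smul,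
    mul_self_inv_mul_inv_sq _ hm, norm_sub_rev, normPow]

theorem kerF_pt_zero (x : E m) (y : E (m + 1)) : kerF (pt x 0) y = kerE (pt x 0) y := by
  have h : ‖pt x 0 - reflect m y‖ = ‖pt x 0 - y‖ := by
    rw [← reflect_pt_zero, ← map_sub, norm_reflect, reflect_pt_zero]
  rw [kerE, kerF, h, reflect_pt_zero]

theorem integrand_eq (hm : 0 < m) (φ : E m → Cl (m + 1)) (y : E (m + 1)) (x : E m) :
    integrand φ y x = (2 : ℝ) • cliffordKernel (y - pt x 0) (projP (φ x)) := by
  have h : φ x + hat m (φ x) = (2 : ℝ) • projP (φ x) := by rw [projP]; module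
  rw [integrand, kerF_pt_zero, ← mul_add, h, kerE_pt_zero hm, mul_smul_comm, cliffordKernel_eq,
    smul_mul_assoc, smul_mul_assoc]
  rfl

theorem boundaryIntegral_eq (hm : 0 < m) (φ : E m → Cl (m + 1)) (y : E (m + 1)) :
    boundaryIntegral φ y = (-(2 ^ m / sphereArea (m + 1)) * y (Fin.last m) ^ (m - 1)) •
      potential cliffordKernel (fun x => projP (φ x)) y := by
  obtain ⟨k, rfl⟩ : ∃ k, m = k + 1 := ⟨m - 1, by omega⟩
  simp only [boundaryIntegral, integrand_eq hm, integral_smul, potential, smul_smul]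
  congr 1
  rw [Nat.add_sub_cancel, pow_succ]
  ring

theorem poissonIntegrand_eq (hm : 0 < m) (ψ : E m → ℝ) (y : E (m + 1)) (x : E m) :
    poissonIntegrand ψ y x = 2 * scalarKernel ℝ m (y - pt x 0) (ψ x) := by
  obtain ⟨k, rfl⟩ : ∃ k, m = k + 1 := ⟨m - 1, by omega⟩
  have h : ‖pt x 0 - reflect (k + 1) y‖ = ‖pt x 0 - y‖ := by
    rw [← reflect_pt_zero, ← map_sub, norm_reflect, reflect_pt_zero]
  have h2 : ∀ r : ℝ, (r ^ 2)⁻¹ ^ (k + 1) = (r ^ (k + 1 + 1) * r ^ k)⁻¹ := fun r => by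
    rw [inv_pow]
    congr 1
    ring
  rw [poissonIntegrand, h, norm_sub_rev, scalarKernel, smul_apply, ContinuousLinearMap.id_apply,
    normPow, Nat.add_sub_cancel, smul_eq_mul, h2, div_eq_mul_inv, div_eq_mul_inv,
    mul_comm (‖y - pt x 0‖ ^ k)]
  ring

theorem poissonIntegral_eq (hm : 0 < m) (ψ : E m → ℝ) (y : E (m + 1)) :
    poissonIntegral ψ y = 2 ^ m / sphereArea (m + 1) *
      (y (Fin.last m) ^ m * potential (scalarKernel ℝ m) ψ y) := by
  obtain ⟨k, rfl⟩ : ∃ k, m = k + 1 := ⟨m - 1, by omega⟩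
  simp only [poissonIntegral, poissonIntegrand_eq hm, integral_const_mul, potential]
  rw [Nat.add_sub_cancel, pow_succ]
  ring

theorem memLp_projP {φ : E m → Cl (m + 1)} {p : ℝ≥0∞} (hφ : MemLp φ p volume) :
    MemLp (fun x => projP (φ x)) p volume :=
  (projPCLM m).comp_memLp' hφ

/-! ### The Dirac-Hodge equation -/

/-- With `T` the Clifford potential and `J` that of `‖z‖^(-2m)`, the kernel identities give `D T =
(m - 1) e_n J` and `Q' T = -e_n T - y_n e_n J`. The product rule for `y_n^(m-1) T` adds `(m - 1)
y_n^(m-2) e_n T`, and everything cancels against `((m - 1) / y_n) Q'`. -/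
theorem isHypermonogenicOn_potential (hm : 2 ≤ m) (c : ℝ) {φ : E m → Cl (m + 1)}
    (hφ : AEStronglyMeasurable φ) (hφ' : Integrable fun x => weight x * ‖φ x‖)
    (hat_φ : ∀ x, hat m (φ x) = φ x) :
    IsHypermonogenicOn (fun y => (c * y (Fin.last m) ^ (m - 1)) • potential cliffordKernel φ y)
      (upperHalf m) := by
  intro y hy
  have hs : 0 < y (Fin.last m) := hy
  have hk := isHomogeneousKernel_cliffordKernel (m := m) (by omega)
  have hq : m + 1 ≤ 2 * m - 1 := by omega
  have hk2 := isHomogeneousKernel_scalarKernel (m := m) (Cl (m + 1)) m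
  have hq2 : m + 1 ≤ 2 * m := by omega
  set T := potential cliffordKernel φ with hT
  set J := potential (scalarKernel (Cl (m + 1)) m) φ y
  have hTd := hasFDerivAt_potential hk hq hφ hφ' hy
  have hproj : HasFDerivAt (fun y : E (m + 1) => y (Fin.last m))
      (EuclideanSpace.proj (Fin.last m) : E (m + 1) →L[ℝ] ℝ) y :=
    (EuclideanSpace.proj (Fin.last m) : E (m + 1) →L[ℝ] ℝ).hasFDerivAt
  have hd : HasFDerivAt (fun y : E (m + 1) => (c * y (Fin.last m) ^ (m - 1)) • T y) _ y :=
    ((hproj.pow (m - 1)).const_mul c).smul hTd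
  refine ⟨hd.differentiableAt, ?_⟩
  have h1 : ∑ j, gen j * potential (derivKernel cliffordKernel) φ y (EuclideanSpace.single j 1) =
      ((m : ℝ) - 1) • (eLast m * J) := by
    let L : (E (m + 1) →L[ℝ] Cl (m + 1)) →L[ℝ] Cl (m + 1) :=
      ∑ j, mulCLM (m + 1) (gen j) ∘L
        ContinuousLinearMap.apply ℝ (Cl (m + 1)) (EuclideanSpace.single j (1 : ℝ))
    have hL : ∀ A, L A = ∑ j, gen j * A (EuclideanSpace.single j 1) := fun A => by
      simp [L]
    have h2 : ((m : ℝ) - 1) • (eLast m * J) = (((m : ℝ) - 1) • mulCLM (m + 1) (eLast m)) J := rfl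
    rw [← hL, clm_potential hk.derivKernel (by omega) hφ hφ' hy, h2,
      clm_potential hk2 hq2 hφ hφ' hy]
    refine integral_congr_ae (Eventually.of_forall fun x => ?_)
    simp only [hL]
    exact sum_gen_mul_derivKernel (sub_pt_ne_zero hy x) _
  have h2 : projQ' (T y) = -(eLast m * T y) - y (Fin.last m) • (eLast m * J) := by
    have h3 : -(eLast m * T y) - y (Fin.last m) • (eLast m * J) =
      -(mulCLM (m + 1) (eLast m) (T y)) - (y (Fin.last m) • mulCLM (m + 1) (eLast m)) J := rfl
    rw [← projQ'CLM_apply, h3, hT, clm_potential hk hq hφ hφ' hy, clm_potential hk hq hφ hφ' hy,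
      clm_potential hk2 hq2 hφ hφ' hy, ← integral_neg, ← integral_sub]
    · refine integral_congr_ae (Eventually.of_forall fun x => ?_)
      have h4 := projQ'_cliffordKernel (y - pt x 0) (hat_φ x)
      -- The last coordinate of `y - x` is `y_n` for every boundary point `x`, so it leaves the
      -- integral.
      rw [PiLp.sub_apply, pt_last, sub_zero] at h4
      exact (projQ'CLM_apply _).trans h4
    · exact ((mulCLM (m + 1) (eLast m)).integrable_comp
        (integrable_potential hk hq hφ hφ' hy)).neg
    · exact (y (Fin.last m) • mulCLM (m + 1) (eLast m)).integrable_comp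
        (integrable_potential hk2 hq2 hφ hφ' hy)
  have hproj_single : ∀ j : Fin (m + 1), (EuclideanSpace.proj (Fin.last m) : E (m + 1) →L[ℝ] ℝ)
      (EuclideanSpace.single j 1) = if Fin.last m = j then 1 else 0 := fun j => by
    simp
  -- The exponents `m - 1` and `m - 2` become free of truncated subtraction.
  obtain ⟨k, rfl⟩ : ∃ k, m = k + 2 := ⟨m - 2, by omega⟩
  have hsum : ∑ j, gen j * fderiv ℝ (fun y : E (k + 2 + 1) =>
        (c * y (Fin.last (k + 2)) ^ (k + 2 - 1)) • T y) y (EuclideanSpace.single j 1) =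
      (c * y (Fin.last (k + 2)) ^ (k + 1)) • (((k + 2 : ℕ) : ℝ) - 1) • (eLast (k + 2) * J) +
        (c * ((k + 1) * y (Fin.last (k + 2)) ^ k)) • (eLast (k + 2) * T y) := by
    rw [hd.fderiv, ← h1, Finset.smul_sum]
    have h5 : ∀ j, gen j * (((c * y (Fin.last (k + 2)) ^ (k + 2 - 1)) •
          potential (derivKernel cliffordKernel) φ y +
          ContinuousLinearMap.smulRight (c • (((k + 2 - 1) • y (Fin.last (k + 2)) ^ (k + 2 - 1 - 1)) •
            (EuclideanSpace.proj (Fin.last (k + 2)) : E (k + 2 + 1) →L[ℝ] ℝ))) (T y))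
          (EuclideanSpace.single j 1)) =
        (c * y (Fin.last (k + 2)) ^ (k + 1)) • (gen j *
          potential (derivKernel cliffordKernel) φ y (EuclideanSpace.single j 1)) +
        if Fin.last (k + 2) = j then
          (c * ((k + 1) * y (Fin.last (k + 2)) ^ k)) • (gen j * T y) else 0 := fun j => by
      simp only [add_apply, smul_apply, ContinuousLinearMap.smulRight_apply, hproj_single]
      rw [mul_add, mul_smul_comm, mul_smul_comm]
      congr 1
      split_ifs <;> simp
    rw [Finset.sum_congr rfl fun j _ => h5 j, Finset.sum_add_distrib, Finset.sum_ite_eq,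
      if_pos (Finset.mem_univ _)]
    rfl
  rw [diracHodge, hsum]
  have h6 : projQ' ((c * y (Fin.last (k + 2)) ^ (k + 2 - 1)) • T y) =
      (c * y (Fin.last (k + 2)) ^ (k + 1)) • projQ' (T y) := by
    rw [← projQ'CLM_apply, map_smul, projQ'CLM_apply]
    rfl
  rw [h6, h2]
  have hs' := hs.ne'
  push_cast
  match_scalars <;> field_simp <;> ring

theorem isHypermonogenicOn_boundaryIntegral (hm : 2 ≤ m) {φ : E m → Cl (m + 1)} {p : ℝ≥0∞}
    (hφ : MemLp φ p volume) (hp₁ : 1 ≤ p) (hp : p < ⊤) :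
    IsHypermonogenicOn (boundaryIntegral φ) (upperHalf m) := by
  have hP := memLp_projP hφ
  rw [funext (boundaryIntegral_eq (by omega) φ)]
  exact isHypermonogenicOn_potential hm _ hP.1 (integrable_weight_mul_norm hP hp₁ hp)
    fun x => hat_projP _

/-! ### Hyperbolic harmonicity of the Poisson integral -/

/-- With `K` the potential of `‖z‖^(-2m-2)`, one has `Δ J = 2m(m + 1) K` and `∂_n J = -2m y_n K`.
Both terms of the equation for `y_n^m J` then equal `m(m - 1) y_n^(m-2) J - 2m(m - 1) y_n^m K`. -/
theorem isHyperbolicHarmonicOn_potential (hm : 0 < m) (c : ℝ) {ψ : E m → ℝ}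
    (hψ : AEStronglyMeasurable ψ) (hψ' : Integrable fun x => weight x * ‖ψ x‖) :
    IsHyperbolicHarmonicOn (fun y => c * (y (Fin.last m) ^ m * potential (scalarKernel ℝ m) ψ y))
      (upperHalf m) := by
  have hk := isHomogeneousKernel_scalarKernel (m := m) ℝ m
  have hq : m + 1 ≤ 2 * m := by omega
  set J := potential (scalarKernel ℝ m) ψ
  set J₁ := potential (derivKernel (scalarKernel ℝ m)) ψ
  set J₂ := potential (derivKernel (derivKernel (scalarKernel ℝ m))) ψ
  set π : E (m + 1) →L[ℝ] ℝ := EuclideanSpace.proj (Fin.last m) with hπ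
  have hJ₁ : ∀ y ∈ upperHalf m, HasFDerivAt J (J₁ y) y := fun y hy =>
    hasFDerivAt_potential hk hq hψ hψ' hy
  have hJ₂ : ∀ y ∈ upperHalf m, HasFDerivAt J₁ (J₂ y) y := fun y hy =>
    hasFDerivAt_potential hk.derivKernel (by omega) hψ hψ' hy
  have hproj : ∀ y : E (m + 1), HasFDerivAt (fun y : E (m + 1) => y (Fin.last m)) π y :=
    fun y => π.hasFDerivAt
  constructor
  · have hJc : ContDiffOn ℝ (2 : ℕ) J (upperHalf m) := contDiffOn_potential 2 hk hq hψ hψ'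
    have hπc : ContDiff ℝ (2 : ℕ) fun y : E (m + 1) => y (Fin.last m) := π.contDiff
    exact_mod_cast contDiffOn_const.mul ((hπc.pow m).contDiffOn.mul hJc)
  intro y hy
  have hs : 0 < y (Fin.last m) := hy
  set u := fun y : E (m + 1) => c * (y (Fin.last m) ^ m * J y) with hu
  obtain ⟨k, rfl⟩ : ∃ k, m = k + 1 := ⟨m - 1, by omega⟩
  have hu₁ : ∀ y ∈ upperHalf (k + 1), HasFDerivAt u (c • (y (Fin.last (k + 1)) ^ (k + 1) • J₁ y +
      (((k : ℝ) + 1) * (J y * y (Fin.last (k + 1)) ^ k)) • π)) y := fun y hy => by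
    refine ((((hproj y).pow (k + 1)).mul (hJ₁ y hy)).const_mul c).congr_fderiv ?_
    ext v
    simp [-mul_eq_mul_left_iff]
    ring
  have hu₂ : HasFDerivAt (fderiv ℝ u) _ y :=
    (((((hproj y).pow (k + 1)).smul (hJ₂ y hy)).add
      (((((hJ₁ y hy).mul ((hproj y).pow k)).const_mul ((k : ℝ) + 1)).smul
        (hasFDerivAt_const π y)))).const_smul c).congr_of_eventuallyEq (by
      filter_upwards [(isOpen_upperHalf _).mem_nhds hy] with z hz using (hu₁ z hz).fderiv)
  have hlap : Laplacian.laplacian u y =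
      ∑ j : Fin (k + 1 + 1), fderiv ℝ (fderiv ℝ u) y (EuclideanSpace.single j 1)
        (EuclideanSpace.single j 1) := by
    rw [InnerProductSpace.laplacian_eq_iteratedFDeriv_orthonormalBasis u
      (EuclideanSpace.basisFun (Fin (k + 1 + 1)) ℝ)]
    simp [iteratedFDeriv_two_apply]
  set K := potential (scalarKernel ℝ (k + 1 + 1)) ψ y with hK
  have h1 : ∑ j : Fin (k + 1 + 1), J₂ y (EuclideanSpace.single j 1) (EuclideanSpace.single j 1) =
      2 * (k + 1) * (k + 2) * K := by
    let L : (E (k + 1 + 1) →L[ℝ] E (k + 1 + 1) →L[ℝ] ℝ) →L[ℝ] ℝ :=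
      ∑ j, ContinuousLinearMap.apply ℝ ℝ (EuclideanSpace.single j (1 : ℝ)) ∘L
        ContinuousLinearMap.apply ℝ (E (k + 1 + 1) →L[ℝ] ℝ) (EuclideanSpace.single j (1 : ℝ))
    have hL : ∀ A, L A = ∑ j, A (EuclideanSpace.single j 1) (EuclideanSpace.single j 1) :=
      fun A => by simp [L]
    rw [← hL, clm_potential hk.derivKernel.derivKernel (by omega) hψ hψ' hy, hK, potential,
      ← integral_const_mul]
    refine integral_congr_ae (Eventually.of_forall fun x => ?_)
    simp only [hL]
    rw [sum_derivKernel_derivKernel _ (sub_pt_ne_zero hy x)]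
    push_cast
    ring
  have h2 : J₁ y (EuclideanSpace.single (Fin.last (k + 1)) 1) =
      -(2 * (k + 1)) * y (Fin.last (k + 1)) * K := by
    have h3 : J₁ y (EuclideanSpace.single (Fin.last (k + 1)) 1) =
      ContinuousLinearMap.apply ℝ ℝ (EuclideanSpace.single (Fin.last (k + 1)) (1 : ℝ)) (J₁ y) := rfl
    rw [h3, clm_potential hk.derivKernel (by omega) hψ hψ' hy, hK, potential,
      ← integral_const_mul]
    refine integral_congr_ae (Eventually.of_forall fun x => ?_)
    simp only [ContinuousLinearMap.apply_apply]
    rw [derivKernel_scalarKernel _ (sub_pt_ne_zero hy x), EuclideanSpace.inner_single_right,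
      PiLp.sub_apply, pt_last, scalarKernel, smul_apply, ContinuousLinearMap.id_apply]
    simp
    ring
  have hπ_single : ∀ j : Fin (k + 1 + 1), π (EuclideanSpace.single j 1) =
      if Fin.last (k + 1) = j then 1 else 0 := fun j => by
    simp [hπ]
  have h3 : ∀ j : Fin (k + 1 + 1), fderiv ℝ (fderiv ℝ u) y (EuclideanSpace.single j 1)
        (EuclideanSpace.single j 1) =
      c * y (Fin.last (k + 1)) ^ (k + 1) * J₂ y (EuclideanSpace.single j 1)
        (EuclideanSpace.single j 1) +
      if Fin.last (k + 1) = j then c * ((k + 1) * (2 * y (Fin.last (k + 1)) ^ k *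
        J₁ y (EuclideanSpace.single j 1) + J y * (k * y (Fin.last (k + 1)) ^ (k - 1))))
      else 0 := fun j => by
    rw [hu₂.fderiv]
    simp [hπ_single]
    split_ifs <;> simp <;> ring
  rw [hlap, Finset.sum_congr rfl fun j _ => h3 j, Finset.sum_add_distrib, ← Finset.mul_sum, h1,
    Finset.sum_ite_eq, if_pos (Finset.mem_univ _), (hu₁ y hy).fderiv]
  simp only [add_apply, smul_apply, hπ_single, h2, smul_eq_mul, if_true]
  have hs' := hs.ne'
  -- In the case `m = 1` the truncated power `y_n^(k-1)` carries the coefficient `k = 0`.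
  rcases k with _ | k
  · simp
    field_simp
    ring
  · push_cast
    field_simp
    ring

/-! ### Boundary values -/

section BoundaryValues

variable {p : ℝ≥0∞}

theorem normPow_pt_one (k : ℕ) (u : E m) : normPow k (pt u 1) = ((1 + ‖u‖ ^ 2) ^ k)⁻¹ := by
  rw [normPow, norm_pt_sq, one_pow, inv_pow, add_comm]

theorem integral_scalarKernel_pt_one (hm : 0 < m) (r : ℝ) :
    ∫ u : E m, scalarKernel ℝ m (pt u 1) r = sphereArea (m + 1) / 2 ^ m * r := by
  rw [← integral_inv_one_add_norm_sq_pow hm, ← integral_mul_const]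
  simp only [scalarKernel, normPow_pt_one, smul_apply, ContinuousLinearMap.id_apply, smul_eq_mul]

theorem vec_pt_add_vec_pt_neg (u : E m) :
    (vec (pt u 1) + vec (pt (-u) 1) : Cl (m + 1)) = (2 : ℝ) • eLast m := by
  rw [eLast, gen, ← map_smul, ← map_add]
  congr 1
  ext i
  refine Fin.lastCases ?_ (fun i => ?_) i
  · simp; norm_num
  · simp

/-- Averaging over `u` and `-u` removes the horizontal part of `(u, 1)`; the vertical part
contributes `e_n e_n = -1`, which the minus sign in front of the boundary integral compensates. -/
theorem integral_cliffordKernel_pt_one (hm : 2 ≤ m) (A : Cl (m + 1)) :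
    ∫ u : E m, cliffordKernel (pt u 1) A = -(sphereArea (m + 1) / 2 ^ m) • A := by
  have hint := integrable_kernel_pt_one
    (isHomogeneousKernel_cliffordKernel (m := m) (by omega)) (by omega) A
  set I := ∫ u : E m, cliffordKernel (pt u 1) A with hI
  have h1 : ∫ u : E m, cliffordKernel (pt (-u) 1) A = I :=
    integral_neg_eq_self (fun u : E m => cliffordKernel (pt u 1) A) volume
  have h2 : ∀ u : E m, cliffordKernel (pt u 1) A + cliffordKernel (pt (-u) 1) A =
      (-2 : ℝ) • (((1 + ‖u‖ ^ 2) ^ m)⁻¹ • A) := fun u => by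
    rw [cliffordKernel_eq, cliffordKernel_eq, normPow_pt_one, normPow_pt_one, norm_neg,
      smul_apply, smul_apply, ← smul_add, vecMulLast_apply, vecMulLast_apply, ← add_mul, ← add_mul,
      vec_pt_add_vec_pt_neg, smul_mul_assoc, eLast_mul_eLast, smul_mul_assoc, neg_one_mul]
    module
  have h3 : I + I = (-2 : ℝ) • ((sphereArea (m + 1) / 2 ^ m) • A) := by
    conv_lhs => rw [← h1]
    rw [h1, ← integral_inv_one_add_norm_sq_pow (by omega), ← integral_smul_const, ← integral_smul]
    nth_rw 2 [← h1]
    rw [hI, ← integral_add hint hint.comp_neg]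
    exact integral_congr_ae (Eventually.of_forall h2)
  have h4 : I = (1 / 2 : ℝ) • (I + I) := by module
  rw [h4, h3]
  module

/-- The prefactor `y_n^(m-1)` is exactly the scaling `s^(q-m)` for `q = 2m - 1`. -/
theorem ae_tendsto_boundaryIntegral (hm : 2 ≤ m) {φ : E m → Cl (m + 1)} (hφ : MemLp φ p volume)
    (hp₁ : 1 ≤ p) (hp : p < ⊤) :
    ∀ᵐ y' : E m, Tendsto (fun s => boundaryIntegral φ (pt y' s)) (𝓝[>] 0)
      (𝓝 (projP (φ y'))) := by
  filter_upwards [ae_tendsto_potential (isHomogeneousKernel_cliffordKernel (m := m) (by omega))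
    (by omega) (memLp_projP hφ) hp₁ hp] with y' hy'
  have h := hy'.const_smul (-(2 ^ m / sphereArea (m + 1)))
  have hω := (sphereArea_pos m).ne'
  have hc : -(2 ^ m / sphereArea (m + 1)) * -(sphereArea (m + 1) / 2 ^ m) = 1 := by
    field_simp
  rw [integral_cliffordKernel_pt_one hm, smul_smul, hc, one_smul] at h
  refine h.congr fun s => ?_
  have hexp : 2 * m - 1 - m = m - 1 := by omega
  rw [boundaryIntegral_eq (by omega), pt_last, mul_smul, hexp]

theorem ae_tendsto_poissonIntegral (hm : 0 < m) {ψ : E m → ℝ} (hψ : MemLp ψ p volume)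
    (hp₁ : 1 ≤ p) (hp : p < ⊤) :
    ∀ᵐ y' : E m, Tendsto (fun s => poissonIntegral ψ (pt y' s)) (𝓝[>] 0) (𝓝 (ψ y')) := by
  filter_upwards [ae_tendsto_potential (isHomogeneousKernel_scalarKernel (m := m) ℝ m)
    (by omega) hψ hp₁ hp] with y' hy'
  have h := hy'.const_mul (2 ^ m / sphereArea (m + 1))
  have hω := (sphereArea_pos m).ne'
  have hc : 2 ^ m / sphereArea (m + 1) * (sphereArea (m + 1) / 2 ^ m) = 1 := by
    field_simp
  rw [integral_scalarKernel_pt_one hm, ← mul_assoc, hc, one_mul] at h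
  refine h.congr fun s => ?_
  have hexp : 2 * m - m = m := by omega
  rw [poissonIntegral_eq hm, pt_last, hexp, smul_eq_mul]

end BoundaryValues

/-- A real density commutes with `z e_n`, whose real part is `-z_n = -y_n`. This cancels the sign in
front and raises the power of `y_n` from `m - 1` to `m`. -/
theorem re_boundaryIntegral (hm : 2 ≤ m) {ψ : E m → ℝ} (hψ : AEStronglyMeasurable ψ)
    (hψ' : Integrable fun x => weight x * ‖ψ x‖) {y : E (m + 1)} (hy : y ∈ upperHalf m) :
    re (boundaryIntegral (fun x => algebraMap ℝ (Cl (m + 1)) (ψ x)) y) = poissonIntegral ψ y := by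
  have hk := isHomogeneousKernel_cliffordKernel (m := m) (by omega)
  let L : ℝ →L[ℝ] Cl (m + 1) := LinearMap.toContinuousLinearMap (Algebra.linearMap ℝ (Cl (m + 1)))
  have hL : ∀ r, algebraMap ℝ (Cl (m + 1)) r = L r := fun r => rfl
  have hLm : AEStronglyMeasurable fun x => L (ψ x) := L.continuous.comp_aestronglyMeasurable hψ
  have hLi : Integrable fun x => weight x * ‖L (ψ x)‖ := by
    refine (hψ'.const_mul ‖L‖).mono' (continuous_weight.aestronglyMeasurable.mul hLm.norm)
      (Eventually.of_forall fun x => ?_)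
    rw [norm_mul, norm_norm, Real.norm_of_nonneg (weight_nonneg x), mul_left_comm]
    exact mul_le_mul_of_nonneg_left (L.le_opNorm _) (weight_nonneg x)
  rw [boundaryIntegral_eq (by omega), poissonIntegral_eq (by omega), ← reCLM_apply, map_smul]
  simp only [projP_algebraMap]
  simp only [hL]
  rw [clm_potential hk (by omega) hLm hLi hy, smul_eq_mul]
  have h : ∀ x, reCLM (m + 1) (cliffordKernel (y - pt x 0) (L (ψ x))) =
      -y (Fin.last m) * scalarKernel ℝ m (y - pt x 0) (ψ x) := fun x => by
    rw [← hL, cliffordKernel_eq, smul_apply, map_smul, vecMulLast_apply, ← Algebra.commutes,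
      ← Algebra.smul_def, map_smul, reCLM_apply, re_vec_mul_eLast, PiLp.sub_apply, pt_last,
      scalarKernel, smul_apply, ContinuousLinearMap.id_apply, smul_eq_mul, smul_eq_mul, smul_eq_mul]
    ring
  simp only [h]
  rw [integral_const_mul, potential]
  obtain ⟨k, rfl⟩ : ∃ k, m = k + 1 := ⟨m - 1, by omega⟩
  rw [Nat.add_sub_cancel]
  ring

end HyperbolicClifford

theorem theorem11 {m : ℕ} (hm : 2 ≤ m) {p : ℝ≥0∞} (hp₁ : 1 < p) (hp : p < ⊤) :
    (∀ φ : E m → Cl (m + 1), MemLp φ p volume →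
      (∀ y ∈ upperHalf m, Integrable (integrand φ y) volume) ∧
      (∀ᵐ y' : E m, ∀ h : ℝ → ℝ, Tendsto h (𝓝[>] 0) (𝓝[>] 0) →
        Tendsto (fun t => boundaryIntegral φ (pt y' (h t))) (𝓝[>] 0) (𝓝 (projP (φ y')))) ∧
      IsHypermonogenicOn (boundaryIntegral φ) (upperHalf m) ∧
      ((∀ᵐ x : E m, φ x ∈ clSub m) →
        ∀ᵐ y' : E m, ∀ h : ℝ → ℝ, Tendsto h (𝓝[>] 0) (𝓝[>] 0) →
          Tendsto (fun t => boundaryIntegral φ (pt y' (h t))) (𝓝[>] 0) (𝓝 (φ y')))) ∧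
    (∀ ψ : E m → ℝ, MemLp ψ p volume →
      (∀ y ∈ upperHalf m, Integrable (poissonIntegrand ψ y) volume ∧
        re (boundaryIntegral (fun x => algebraMap ℝ (Cl (m + 1)) (ψ x)) y) =
          poissonIntegral ψ y) ∧
      IsHyperbolicHarmonicOn (poissonIntegral ψ) (upperHalf m) ∧
      (∀ᵐ y' : E m, ∀ h : ℝ → ℝ, Tendsto h (𝓝[>] 0) (𝓝[>] 0) →
        Tendsto (fun t => poissonIntegral ψ (pt y' (h t))) (𝓝[>] 0) (𝓝 (ψ y')))) := by
  have hp₁ := hp₁.le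
  refine ⟨fun φ hφ => ⟨fun y hy => ?_, ?_, isHypermonogenicOn_boundaryIntegral hm hφ hp₁ hp,
    fun hmem => ?_⟩, fun ψ hψ => ⟨fun y hy => ⟨?_, ?_⟩, ?_, ?_⟩⟩
  · have hP := memLp_projP hφ
    rw [funext (integrand_eq (by omega) φ y)]
    exact (integrable_potential (isHomogeneousKernel_cliffordKernel (by omega)) (by omega) hP.1
      (integrable_weight_mul_norm hP hp₁ hp) hy).smul (2 : ℝ)
  -- The limit holds as the height tends to `0⁺`, so one null set serves every approach `h`.
  · filter_upwards [ae_tendsto_boundaryIntegral hm hφ hp₁ hp] with y' hy' h hh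
    exact hy'.comp hh
  · filter_upwards [ae_tendsto_boundaryIntegral hm hφ hp₁ hp, hmem] with y' hy' hmem h hh
    rw [projP_of_mem hmem] at hy'
    exact hy'.comp hh
  · rw [funext (poissonIntegrand_eq (by omega) ψ y)]
    exact (integrable_potential (isHomogeneousKernel_scalarKernel ℝ m) (by omega) hψ.1
      (integrable_weight_mul_norm hψ hp₁ hp) hy).const_mul 2
  · exact re_boundaryIntegral hm hψ.1 (integrable_weight_mul_norm hψ hp₁ hp) hy
  · rw [funext (poissonIntegral_eq (by omega) ψ)]
    exact isHyperbolicHarmonicOn_potential (by omega) _ hψ.1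
      (integrable_weight_mul_norm hψ hp₁ hp)
  · filter_upwards [ae_tendsto_poissonIntegral (by omega) hψ hp₁ hp] with y' hy' h hh
    exact hy'.comp hh
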